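/- **Theorem (consistency of the projective forward Euler scheme).** Consider the scalar equation $\partial_t u+\partial_xA(u)=\partial_{xx}B(u)$ on $\mathbb R$ and its discrete-velocity BGK approximation with $L=J+2$ components, $$\partial_t f_l+\gamma_l^\varepsilon\,\partial_x f_l=\tfrac1\varepsilon\big(M_l(u^\varepsilon)-f_l\big),\qquad u^\varepsilon=\sum_{l=1}^{L} f_l,$$ with $\gamma_l^\varepsilon=\lambda_l$ for $l\le J$, $\gamma^\varepsilon_{J+1}=-\gamma^\varepsilon_{J+2}=-\big(\tfrac{\mu}{\sqrt2}+\tfrac{\theta}{\sqrt\varepsilon}\big)$, $\mu\ge0$, $\theta>0$, $M_{J+1}=M_{J+2}=B/(2\theta^2)$, where $A,B,M_l$ are smooth, $\sum_l M_l(w)=w$ and $\sum_l\gamma_l^\varepsilon M_l(w)=A(w)$ for all $w$. *Scheme.* On the grid $x_i=x_0+i\Delta x$, $i\in\mathbb Z$, let $\Phi^\varepsilon(f)_{l,i}=(F_{l,i+1/2}-F_{l,i-1/2})/\Delta x$. For $l\le J$ use the second-order upwind flux: $F_{l,i+1/2}=\gamma_l(3f_{l,i}-f_{l,i-1})/2$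 if $\gamma_l>0$ and $\gamma_l(3f_{l,i+1}-f_{l,i+2})/2$ otherwise. For $l=J+1,J+2$ use the centered flux $F_{l,i+1/2}=\gamma_l(f_{l,i}+f_{l,i+1})/2$. From $f^{N,0}=f^N$ do $K+1$ inner steps $f^{N,k+1}=f^{N,k}+\delta t\,\big(-\Phi^\varepsilon(f^{N,k})+\tfrac1\varepsilon(M(u^{N,k})-f^{N,k})\big)$ with $\delta t=\varepsilon$ and fixed $K\ge2$, and set $f^{N+1}=f^{N,K+1}+(\Delta t-(K+1)\delta t)\,(f^{N,K+1}-f^{N,K})/\delta t$, $u^{N+1}_i=\sum_l f^{N+1}_{l,i}$. With $t^N=N\Delta t$, the macroscopic truncation error is $E^{N+1}_i=\big(\tilde u(x_i,t^{N+1})-u_i^{N+1}\big)/\Delta t$, where one step is taken from exact data at time $t^N$. Fix the model, $K$, $T>0$, constants $0<\kappa_1\le\kappa_2$, and bounds $R_0,R_1,\dots$. "Smooth solution" means a smooth solution on $\mathbb R\times[0,T]$ whose derivatives of order $n$ are bounded by $R_n$ for every $n$ (uniformly in $\varepsilon$, for the kinetic system). In (1), (2) and (4), $(N+1)\Delta t\le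 T$; $C$ depends only on the fixed data, not on $\varepsilon,\Delta x,\Delta t,N,i,x_0$ or the solution. In (1) and (2), assume $0<\varepsilon\le1$ and the parabolic CFL scaling $\kappa_1\Delta x^2\le\Delta t\le\kappa_2\Delta x^2$. 1. If $f^N$ consists of the values at time $t^N$ of a smooth solution of the kinetic system, and $\tilde u$ is its density, then $$|E_i^{N+1}|\le C\Big(\varepsilon+\Delta t+\frac{\varepsilon^2}{\Delta t}\Big).$$ 2. If $\tilde u$ is a smooth solution of the parabolic equation and $f^N$ consists of the grid values of a smooth Chapman–Enskog state with density $\tilde u(\cdot,t^N)$, that is, $M(\tilde u)-\varepsilon\Gamma^\varepsilon\partial_xM(\tilde u)+\rho$, where for every $n$ the derivatives of order $n$ of each $\rho_l$ and of $\sum_l\gamma_l^\varepsilon\rho_l$ are bounded by $R_n\varepsilon$, then $$|E_i^{N+1}|\le C\Big(\varepsilon+\mu\sqrt\varepsilon+\Delta t+\frac{\varepsilon^2}{\Delta t}\Big);$$ in particular, for $\mu=0$, $E^{N+1}=\mathcal O(\varepsilon)+\mathcal O(\Delta t)+\mathcal O(\varepsilon^2/\Delta t)$. 3. For fixed $\Delta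 x,\Delta t>0$ and any initial kinetic grid data with density $U^0$ that stay bounded at each grid point for $0<\varepsilon\le 1$, the densities $u^n_i$ of the scheme converge as $\varepsilon\to0$, for all $n$ and $i$, to the iterates of $$U_i^{n+1}=U_i^n-\frac{\Delta t}{\Delta x}\sum_{l=1}^{J}\big(G_{l,i+1/2}^n-G_{l,i-1/2}^n\big)+\Delta t\,\frac{B(U_{i+2}^n)-2B(U_i^n)+B(U_{i-2}^n)}{4\Delta x^2},$$ where $G_{l,i+1/2}^n$ is the second-order upwind flux of velocity $\lambda_l$ applied to $M_l(U^n)$. 4. This limiting scheme is consistent with the parabolic equation at order one in time and two in space: for every smooth solution $\tilde u$ and all $\Delta x,\Delta t>0$, its truncation error is bounded by $C(\Delta t+\Delta x^2)$. -/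

import Mathlib

open scoped ContDiff Topology

noncomputable section

/-- Scalar one-dimensional discrete-velocity BGK model for `∂ₜ u + ∂ₓ A(u) = ∂ₓₓ B(u)` with `J`
velocities `λ₁, …, λ_J` for the transport part and the two velocities
`∓ (μ / √2 + θ / √ε)` for the diffusive part, whose Maxwellians are `B(u) / (2 θ²)`.
`sum_maxw` and `sum_lam_maxw` are the compatibility conditions `∑ M_l(w) = w` and
`∑ γ_l M_l(w) = A(w)`: the two diffusive components contribute `B(w) / θ²` to the first sum and
cancel in the second. The third condition `∑ θ_l² M_l(w) = B(w)` holds by construction. -/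
structure KineticModel (J : ℕ) where
  A : ℝ → ℝ
  B : ℝ → ℝ
  lam : Fin J → ℝ
  maxw : Fin J → ℝ → ℝ
  mu : ℝ
  theta : ℝ
  mu_nonneg : 0 ≤ mu
  theta_pos : 0 < theta
  smooth_A : ContDiff ℝ ∞ A
  smooth_B : ContDiff ℝ ∞ B
  smooth_maxw : ∀ l, ContDiff ℝ ∞ (maxw l)
  sum_maxw : ∀ w, ∑ l, maxw l w + B w / theta ^ 2 = w
  sum_lam_maxw : ∀ w, ∑ l, lam l * maxw l w = A w

/-- Kinetic grid functions `f_{l,i}`: the components `Sum.inl l` are the first `J` ones,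
`Sum.inr 0` and `Sum.inr 1` are the components `J + 1` and `J + 2`. -/
abbrev KineticGrid (J : ℕ) := Fin J ⊕ Fin 2 → ℤ → ℝ

/-- Macroscopic density `u_i = ∑_l f_{l,i}`. -/
def gridDensity {J : ℕ} (f : KineticGrid J) (i : ℤ) : ℝ := ∑ l, f l i

/-- Second-order upwind flux at `x_{i+1/2}` for the velocity `γ`. -/
def upwindFlux (γ : ℝ) (g : ℤ → ℝ) (i : ℤ) : ℝ :=
  if 0 < γ then γ * ((3 * g i - g (i - 1)) / 2) else γ * ((3 * g (i + 1) - g (i + 2)) / 2)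

/-- Second-order centered flux at `x_{i+1/2}` for the velocity `γ`. -/
def centeredFlux (γ : ℝ) (g : ℤ → ℝ) (i : ℤ) : ℝ := γ * ((g i + g (i + 1)) / 2)

/-- A function of `x` sampled at the nodes `x_i = x₀ + i Δx`. -/
def sampleAt (x₀ Δx : ℝ) (g : ℝ → ℝ) (i : ℤ) : ℝ := g (x₀ + i * Δx)

/-- The derivatives of every order `n` of `w(x, t)` are bounded by `R n` for `0 ≤ t ≤ T`. -/
def HasDerivBounds (T : ℝ) (R : ℕ → ℝ) (w : ℝ → ℝ → ℝ) : Prop :=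
  ∀ (n : ℕ) (x t : ℝ), 0 ≤ t → t ≤ T →
    ‖iteratedFDeriv ℝ n (fun p : ℝ × ℝ => w p.1 p.2) (x, t)‖ ≤ R n

/-- Macroscopic truncation error `(ũ(x_i, t) - v_i) / Δt` of the computed values `v` with respect
to the exact solution `ũ` at the new time `t`. -/
def truncationError (x₀ Δx Δt : ℝ) (exact : ℝ → ℝ → ℝ) (t : ℝ) (v : ℤ → ℝ) (i : ℤ) : ℝ :=
  (sampleAt x₀ Δx (fun x => exact x t) i - v i) / Δt

namespace KineticModel

variable {J : ℕ} (m : KineticModel J)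

/-- The diagonal entries of `Γ^ε`. -/
def velocity (ε : ℝ) : Fin J ⊕ Fin 2 → ℝ :=
  Sum.elim m.lam
    ![-(m.mu / √2 + m.theta / √ε), m.mu / √2 + m.theta / √ε]

/-- All Maxwellians. -/
def maxwellian : Fin J ⊕ Fin 2 → ℝ → ℝ :=
  Sum.elim m.maxw (fun _ w => m.B w / (2 * m.theta ^ 2))

/-- Numerical flux at `x_{i+1/2}`: upwind for the first `J` components, centered for the last two. -/
def flux (ε : ℝ) (f : KineticGrid J) : KineticGrid J :=
  Sum.elim (fun l => upwindFlux (m.velocity ε (Sum.inl l)) (f (Sum.inl l)))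
    (fun k => centeredFlux (m.velocity ε (Sum.inr k)) (f (Sum.inr k)))

/-- Discretized convective derivative `Φ^ε(f)`. -/
def convection (ε Δx : ℝ) (f : KineticGrid J) : KineticGrid J :=
  fun l i => (m.flux ε f l i - m.flux ε f l (i - 1)) / Δx

/-- One forward Euler step of size `δt` for `f' = -Φ^ε(f) + (M(u) - f) / ε`. -/
def innerStep (ε δt Δx : ℝ) (f : KineticGrid J) : KineticGrid J :=
  fun l i => f l i +
    δt * (-m.convection ε Δx f l i + (m.maxwellian l (gridDensity f i) - f l i) / ε)

/-- One step of the projective forward Euler scheme: `K + 1` inner steps of size `δt`, followed by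
extrapolation over `Δt - (K + 1) δt`. -/
def pfeStep (K : ℕ) (ε δt Δt Δx : ℝ) (f : KineticGrid J) : KineticGrid J :=
  fun l i => (m.innerStep ε δt Δx)^[K + 1] f l i +
    (Δt - (K + 1) * δt) *
      (((m.innerStep ε δt Δx)^[K + 1] f l i - (m.innerStep ε δt Δx)^[K] f l i) / δt)

/-- `f` is smooth and solves the kinetic system on `ℝ × [0, T]`. -/
def IsKineticSolution (ε T : ℝ) (f : Fin J ⊕ Fin 2 → ℝ → ℝ → ℝ) : Prop :=
  (∀ l, ContDiff ℝ ∞ (fun p : ℝ × ℝ => f l p.1 p.2)) ∧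
  ∀ (l : Fin J ⊕ Fin 2) (x t : ℝ), 0 ≤ t → t ≤ T →
    deriv (fun s => f l x s) t + m.velocity ε l * deriv (fun y => f l y t) x =
      (1 / ε) * (m.maxwellian l (∑ k, f k x t) - f l x t)

/-- `u` is smooth and solves `∂ₜ u + ∂ₓ A(u) = ∂ₓₓ B(u)` on `ℝ × [0, T]`. -/
def IsParabolicSolution (T : ℝ) (u : ℝ → ℝ → ℝ) : Prop :=
  ContDiff ℝ ∞ (fun p : ℝ × ℝ => u p.1 p.2) ∧
  ∀ x t : ℝ, 0 ≤ t → t ≤ T →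
    deriv (fun s => u x s) t + deriv (fun y => m.A (u y t)) x =
      iteratedDeriv 2 (fun y => m.B (u y t)) x

/-- Remainder `φ_l - (M_l(w) - ε γ_l ∂ₓ M_l(w))` of the Chapman–Enskog expansion. -/
def expansionRemainder (ε : ℝ) (w : ℝ → ℝ) (φ : Fin J ⊕ Fin 2 → ℝ → ℝ)
    (l : Fin J ⊕ Fin 2) (x : ℝ) : ℝ :=
  φ l x - (m.maxwellian l (w x) - ε * m.velocity ε l * deriv (fun y => m.maxwellian l (w y)) x)

/-- The kinetic state `φ` has density `w` and follows the Chapman–Enskog expansion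
`φ = M(w) - ε Γ ∂ₓ M(w) + ρ`, where `ρ_l` and `∑_l γ_l ρ_l` are `O(ε)` with all their derivatives
(with the bounds `R n`). -/
def IsChapmanEnskogState (ε : ℝ) (R : ℕ → ℝ) (w : ℝ → ℝ) (φ : Fin J ⊕ Fin 2 → ℝ → ℝ) : Prop :=
  (∀ l, ContDiff ℝ ∞ (φ l)) ∧
  (∀ x, ∑ l, φ l x = w x) ∧
  (∀ l (n : ℕ) (x : ℝ), |iteratedDeriv n (m.expansionRemainder ε w φ l) x| ≤ R n * ε) ∧
  ∀ (n : ℕ) (x : ℝ),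
    |iteratedDeriv n (fun y => ∑ l, m.velocity ε l * m.expansionRemainder ε w φ l y) x| ≤ R n * ε

/-- One step of the limiting explicit scheme for `∂ₜ u + ∂ₓ A(u) = ∂ₓₓ B(u)`. -/
def limitStep (Δt Δx : ℝ) (U : ℤ → ℝ) : ℤ → ℝ := fun i =>
  U i
    - Δt * (∑ l, (upwindFlux (m.lam l) (fun j => m.maxw l (U j)) i
        - upwindFlux (m.lam l) (fun j => m.maxw l (U j)) (i - 1)) / Δx)
    + Δt * ((m.B (U (i + 2)) - 2 * m.B (U i) + m.B (U (i - 2))) / (4 * Δx ^ 2))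

end KineticModel

end

/-! Write `c` for the diffusive speed, `Φ` for the discrete convection, `s` and `d` for the sum and
the difference of the two diffusive components. The scaling facts are that `ε c²` is bounded and
tends to `θ²`, and that `ε c = O(√ε)`.

With `δt = ε` an inner step is `f ↦ M(u) - ε Φ(f)`: relaxation is complete in one step, and the
density changes by `-ε S` with `S = ∑ Φ_l(f)`. If `S_k` is this rate at the `k`-th inner state, the
projective step changes the density by `-ε ∑_{k ≤ K} S_k - (Δt - (K+1) ε) S_K`. It is therefore
enough to show that every `S_k` differs by `O(ε + Δx²)` from `Q = ∂ₓA(u) - (ε c²/θ²) ∂ₓₓB(u)`; the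
error is then `O((1 + ε/Δt)(ε + Δx²))`, which the parabolic scaling turns into `O(ε + Δt + ε²/Δt)`.

The difficulty is that `Φ` contains the unbounded speed `c`. In the sum over components only the
flux `c d` survives, and after an inner step it equals `-ε c² D s`, with `D` the centered quotient.
The class `IsWellPrepared` records exactly what is needed (density, transport components, `s` and `c
d` close to their equilibrium values). `IsWellPrepared.innerStepFn` shows that an inner step
preserves it, and `IsWellPrepared.isSmoothO_rate` yields `S = Q + O(ε + Δx²)`. Kinetic solutions and
Chapman–Enskog states both belong to it. For a kinetic solution `∂ₜu` is itself `-Q` up to the same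
error, so the defect `1 - ε c²/θ²` never enters; against the parabolic equation this defect costs
`μ√ε`.

Uniform constants come from `IsSmoothO`, a calculus of families indexed by an arbitrary parameter
type. Taking as parameter the whole configuration (solution, time, `ε`, mesh) makes every constant
independent of it. Inner steps act on smooth functions of a continuous variable, so derivatives of
all iterates are available.

For the limit on a fixed grid, data that are merely bounded become, after one inner step, a state
with limit `M(U)` and `d = O(√ε)`; after a second one `c d` converges to `-D B(U)`. Hence `K ≥ 2`
makes `S_K` converge to the limiting rate, and makes the last inner increment `O(ε)` in each
component, so that extrapolation keeps the data bounded and time steps can be iterated. -/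

noncomputable section

/-! ### Uniform derivative bounds for parametrized families -/

/-- The functions `g p` are smooth and, for every `n`, their derivatives of order `n` are bounded by
a constant multiple of `w p`, uniformly in the parameter `p`. -/
def IsSmoothO {P : Type*} (w : P → ℝ) (g : P → ℝ → ℝ) : Prop :=
  (∀ p, ContDiff ℝ ∞ (g p)) ∧ ∀ n : ℕ, ∃ C : ℝ, ∀ p x, |iteratedDeriv n (g p) x| ≤ C * w p

/-- Uniform bounds, up to order `n`, of the derivatives of a family by multiples of a weight. -/
def DerivBoundUpTo {P : Type*} (n : ℕ) (w : P → ℝ) (g : P → ℝ → ℝ) : Prop :=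
  ∀ k ≤ n, ∃ C : ℝ, ∀ p x, |iteratedDeriv k (g p) x| ≤ C * w p

theorem ContDiff.deriv_infty {g : ℝ → ℝ} (hg : ContDiff ℝ ∞ g) : ContDiff ℝ ∞ (deriv g) :=
  (contDiff_infty_iff_deriv.1 hg).2

theorem ContDiff.differentiable_infty {E : Type*} [NormedAddCommGroup E] [NormedSpace ℝ E]
    {g : E → ℝ} (hg : ContDiff ℝ ∞ g) : Differentiable ℝ g :=
  hg.differentiable (by simp)

theorem ContDiff.iteratedDeriv_infty {g : ℝ → ℝ} (hg : ContDiff ℝ ∞ g) (n : ℕ) :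
    ContDiff ℝ ∞ (iteratedDeriv n g) := by
  induction n with
  | zero => simpa using hg
  | succ n ih => rw [iteratedDeriv_succ]; exact ih.deriv_infty

section DerivBoundUpTo

variable {P : Type*} {v w : P → ℝ} {f g : P → ℝ → ℝ} {n : ℕ}

theorem derivBoundUpTo_zero :
    DerivBoundUpTo 0 w g ↔ ∃ C : ℝ, ∀ p x, |g p x| ≤ C * w p := by
  simp [DerivBoundUpTo]

theorem derivBoundUpTo_succ :
    DerivBoundUpTo (n + 1) w g ↔
      (∃ C : ℝ, ∀ p x, |g p x| ≤ C * w p) ∧ DerivBoundUpTo n w fun p => deriv (g p) := by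
  constructor
  · intro h
    refine ⟨by simpa using h 0 (by omega), fun k hk => ?_⟩
    simpa [iteratedDeriv_succ'] using h (k + 1) (by omega)
  · rintro ⟨h0, h⟩ k hk
    cases k with
    | zero => simpa using h0
    | succ k => simpa [iteratedDeriv_succ'] using h k (by omega)

theorem DerivBoundUpTo.bound (h : DerivBoundUpTo n w g) :
    ∃ C : ℝ, ∀ p x, |g p x| ≤ C * w p := by
  simpa using h 0 (Nat.zero_le n)

theorem DerivBoundUpTo.of_le {k : ℕ} (h : DerivBoundUpTo n w g) (hk : k ≤ n) :
    DerivBoundUpTo k w g := fun j hj => h j (hj.trans hk)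

theorem DerivBoundUpTo.add (hf' : ∀ p, ContDiff ℝ ∞ (f p)) (hg' : ∀ p, ContDiff ℝ ∞ (g p))
    (hf : DerivBoundUpTo n w f) (hg : DerivBoundUpTo n w g) :
    DerivBoundUpTo n w fun p x => f p x + g p x := by
  intro k hk
  obtain ⟨C, hC⟩ := hf k hk
  obtain ⟨D, hD⟩ := hg k hk
  refine ⟨C + D, fun p x => ?_⟩
  have e : iteratedDeriv k (fun x => f p x + g p x) x
      = iteratedDeriv k (f p) x + iteratedDeriv k (g p) x :=
    iteratedDeriv_fun_add ((hf' p).contDiffAt.of_le (by exact_mod_cast le_top))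
      ((hg' p).contDiffAt.of_le (by exact_mod_cast le_top))
  rw [e, add_mul]
  exact (abs_add_le _ _).trans (add_le_add (hC p x) (hD p x))

/-- The Leibniz rule, one derivative at a time: each term keeps one factor undifferentiated, so the
induction needs the bounds of all lower orders at once. -/
theorem DerivBoundUpTo.mul (hf' : ∀ p, ContDiff ℝ ∞ (f p)) (hg' : ∀ p, ContDiff ℝ ∞ (g p))
    (hf : DerivBoundUpTo n v f) (hg : DerivBoundUpTo n w g) :
    DerivBoundUpTo n (fun p => v p * w p) fun p x => f p x * g p x := by
  have base : ∃ C : ℝ, ∀ p x, |f p x * g p x| ≤ C * (v p * w p) := by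
    obtain ⟨C, hC⟩ := hf.bound
    obtain ⟨D, hD⟩ := hg.bound
    refine ⟨C * D, fun p x => ?_⟩
    rw [abs_mul]
    calc |f p x| * |g p x| ≤ (C * v p) * (D * w p) :=
          mul_le_mul (hC p x) (hD p x) (abs_nonneg _) ((abs_nonneg _).trans (hC p x))
      _ = _ := by ring
  induction n generalizing f g with
  | zero => exact derivBoundUpTo_zero.2 base
  | succ n ih =>
    refine derivBoundUpTo_succ.2 ⟨base, ?_⟩
    have e : (fun p => deriv fun x => f p x * g p x)
        = fun p x => deriv (f p) x * g p x + f p x * deriv (g p) x := by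
      funext p x
      exact deriv_fun_mul ((hf' p).differentiable_infty x) ((hg' p).differentiable_infty x)
    rw [e]
    have hfd := (derivBoundUpTo_succ.1 hf).2
    have hgd := (derivBoundUpTo_succ.1 hg).2
    have hf1 := hf.of_le (Nat.le_succ n)
    have hg1 := hg.of_le (Nat.le_succ n)
    -- The induction hypothesis takes the order-zero bound of the product as a premise, so it is
    -- supplied anew for each of the two Leibniz terms.
    have aux : ∀ {a b : P → ℝ → ℝ}, DerivBoundUpTo n v a → DerivBoundUpTo n w b →
        ∃ C : ℝ, ∀ p x, |a p x * b p x| ≤ C * (v p * w p) := by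
      intro a b ha hb
      obtain ⟨C, hC⟩ := ha.bound
      obtain ⟨D, hD⟩ := hb.bound
      refine ⟨C * D, fun p x => ?_⟩
      rw [abs_mul]
      calc |a p x| * |b p x| ≤ (C * v p) * (D * w p) :=
            mul_le_mul (hC p x) (hD p x) (abs_nonneg _) ((abs_nonneg _).trans (hC p x))
        _ = _ := by ring
    exact DerivBoundUpTo.add (fun p => (hf' p).deriv_infty.mul (hg' p))
      (fun p => (hf' p).mul (hg' p).deriv_infty)
      (ih (fun p => (hf' p).deriv_infty) hg' hfd hg1 (aux hfd hg1))
      (ih hf' (fun p => (hg' p).deriv_infty) hf1 hgd (aux hf1 hgd))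

end DerivBoundUpTo

namespace IsSmoothO

variable {P : Type*} {v w : P → ℝ} {f g : P → ℝ → ℝ}

theorem derivBoundUpTo (h : IsSmoothO w g) (n : ℕ) : DerivBoundUpTo n w g := fun k _ => h.2 k

theorem of_derivBoundUpTo (hg : ∀ p, ContDiff ℝ ∞ (g p)) (h : ∀ n, DerivBoundUpTo n w g) :
    IsSmoothO w g := ⟨hg, fun n => h n n le_rfl⟩

theorem bound (h : IsSmoothO w g) : ∃ C : ℝ, ∀ p x, |g p x| ≤ C * w p := by
  simpa using h.2 0

protected theorem deriv (h : IsSmoothO w g) : IsSmoothO w fun p => deriv (g p) := by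
  refine ⟨fun p => (h.1 p).deriv_infty, fun n => ?_⟩
  obtain ⟨C, hC⟩ := h.2 (n + 1)
  exact ⟨C, fun p x => by simpa [iteratedDeriv_succ'] using hC p x⟩

theorem add (hf : IsSmoothO w f) (hg : IsSmoothO w g) :
    IsSmoothO w fun p x => f p x + g p x :=
  of_derivBoundUpTo (fun p => (hf.1 p).add (hg.1 p))
    fun n => .add hf.1 hg.1 (hf.derivBoundUpTo n) (hg.derivBoundUpTo n)

/-- The factor may depend on the parameter: this is how factors such as `ε` and `ε c` are converted
into weights. -/
theorem const_mul_of_le (hg : IsSmoothO w g) (c : P → ℝ) (K : ℝ)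
    (hc : ∀ p, |c p| * |w p| ≤ K * v p) : IsSmoothO v fun p x => c p * g p x := by
  refine ⟨fun p => contDiff_const.mul (hg.1 p), fun n => ?_⟩
  obtain ⟨C, hC⟩ := hg.2 n
  refine ⟨|C| * K, fun p x => ?_⟩
  have e : iteratedDeriv n (fun x => c p * g p x) x = c p * iteratedDeriv n (g p) x :=
    iteratedDeriv_const_mul_field _ _
  rw [e, abs_mul]
  calc |c p| * |iteratedDeriv n (g p) x| ≤ |c p| * (|C| * |w p|) := by
        refine mul_le_mul_of_nonneg_left ?_ (abs_nonneg _)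
        rw [← abs_mul]
        exact (hC p x).trans (le_abs_self _)
    _ = |C| * (|c p| * |w p|) := by ring
    _ ≤ |C| * (K * v p) := mul_le_mul_of_nonneg_left (hc p) (abs_nonneg _)
    _ = _ := by ring

theorem const_mul (hg : IsSmoothO w g) (c : ℝ) : IsSmoothO w fun p x => c * g p x := by
  refine ⟨fun p => contDiff_const.mul (hg.1 p), fun n => ?_⟩
  obtain ⟨C, hC⟩ := hg.2 n
  refine ⟨|c| * C, fun p x => ?_⟩
  have e : iteratedDeriv n (fun x => c * g p x) x = c * iteratedDeriv n (g p) x :=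
    iteratedDeriv_const_mul_field _ _
  rw [e, abs_mul, mul_assoc]
  exact mul_le_mul_of_nonneg_left (hC p x) (abs_nonneg _)

theorem mono (hg : IsSmoothO w g) (K : ℝ) (h : ∀ p, |w p| ≤ K * v p) : IsSmoothO v g := by
  simpa using hg.const_mul_of_le (fun _ => 1) K (by simpa using h)

theorem neg (hg : IsSmoothO w g) : IsSmoothO w fun p x => -g p x := by
  simpa using hg.const_mul (-1)

theorem sub (hf : IsSmoothO w f) (hg : IsSmoothO w g) :
    IsSmoothO w fun p x => f p x - g p x := by
  simpa [sub_eq_add_neg] using hf.add hg.neg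

theorem zero : IsSmoothO w fun _ _ => 0 :=
  ⟨fun _ => contDiff_const, fun n => ⟨0, fun p x => by simp⟩⟩

theorem sum {ι : Type*} (s : Finset ι) {F : ι → P → ℝ → ℝ} (h : ∀ i ∈ s, IsSmoothO w (F i)) :
    IsSmoothO w fun p x => ∑ i ∈ s, F i p x := by
  classical
  induction s using Finset.induction_on with
  | empty => simpa using zero
  | insert a s ha ih =>
    simp only [Finset.sum_insert ha]
    exact (h a (by simp)).add (ih fun i hi => h i (by simp [hi]))

theorem congr (h : IsSmoothO w f) (e : ∀ p x, g p x = f p x) : IsSmoothO w g := by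
  have : g = f := by funext p x; exact e p x
  exact this ▸ h

end IsSmoothO

/-! ### Composition with smooth nonlinearities -/

section Composition

variable {P : Type*} {w : P → ℝ} {u v : P → ℝ → ℝ}

/-- All values of the family lie in one compact interval, on which the continuous function `F` is
bounded. -/
theorem exists_bound_comp {F : ℝ → ℝ} (hF : ContDiff ℝ ∞ F) (hu : IsSmoothO (fun _ => 1) u) :
    ∃ C : ℝ, ∀ p x, |F (u p x)| ≤ C * 1 := by
  obtain ⟨M, hM⟩ := hu.bound
  obtain ⟨C, hC⟩ := (isCompact_Icc (a := -M) (b := M)).exists_bound_of_continuousOn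
    hF.continuous.continuousOn
  refine ⟨C, fun p x => ?_⟩
  simpa using hC (u p x) (abs_le.1 (by simpa using hM p x))

theorem deriv_comp_infty {F g : ℝ → ℝ} (hF : ContDiff ℝ ∞ F) (hg : ContDiff ℝ ∞ g) (x : ℝ) :
    deriv (fun y => F (g y)) x = deriv F (g x) * deriv g x :=
  deriv_comp x (hF.differentiable_infty _) (hg.differentiable_infty _)

/-- The induction runs over all `F` simultaneously, because the chain rule replaces `F` by its
derivative. -/
theorem derivBoundUpTo_comp (hu : IsSmoothO (fun _ => 1) u) (n : ℕ) :
    ∀ F : ℝ → ℝ, ContDiff ℝ ∞ F → DerivBoundUpTo n (fun _ => 1) fun p x => F (u p x) := by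
  induction n with
  | zero => exact fun F hF => derivBoundUpTo_zero.2 (exists_bound_comp hF hu)
  | succ n ih =>
    intro F hF
    refine derivBoundUpTo_succ.2 ⟨exists_bound_comp hF hu, ?_⟩
    have e : (fun p => deriv fun x => F (u p x)) = fun p x => deriv F (u p x) * deriv (u p) x := by
      funext p x; exact deriv_comp_infty hF (hu.1 p) x
    rw [e]
    simpa using DerivBoundUpTo.mul (fun p => hF.deriv_infty.comp (hu.1 p))
      (fun p => (hu.1 p).deriv_infty) (ih _ hF.deriv_infty) (hu.deriv.derivBoundUpTo n)

/-- Composition with a smooth function preserves uniform smoothness. -/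
theorem IsSmoothO.comp {F : ℝ → ℝ} (hF : ContDiff ℝ ∞ F) (hu : IsSmoothO (fun _ => 1) u) :
    IsSmoothO (fun _ => 1) fun p x => F (u p x) :=
  .of_derivBoundUpTo (fun p => hF.comp (hu.1 p)) fun n => derivBoundUpTo_comp hu n F hF

/-- Mean value inequality on a compact interval containing the values of both families. -/
theorem exists_bound_comp_sub {F : ℝ → ℝ} (hF : ContDiff ℝ ∞ F) (hu : IsSmoothO (fun _ => 1) u)
    (hv : IsSmoothO (fun _ => 1) v) (huv : IsSmoothO w fun p x => u p x - v p x) :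
    ∃ C : ℝ, ∀ p x, |F (u p x) - F (v p x)| ≤ C * w p := by
  obtain ⟨M, hM⟩ := hu.bound
  obtain ⟨N, hN⟩ := hv.bound
  obtain ⟨D, hD⟩ := huv.bound
  obtain ⟨C, hC⟩ := (isCompact_Icc (a := -max M N) (b := max M N)).exists_bound_of_continuousOn
    hF.deriv_infty.continuous.continuousOn
  refine ⟨|C| * D, fun p x => ?_⟩
  have hmem : ∀ {y : ℝ}, |y| ≤ max M N → y ∈ Set.Icc (-max M N) (max M N) := abs_le.1
  have hu' := hmem ((by simpa using hM p x : |u p x| ≤ M).trans (le_max_left _ _))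
  have hv' := hmem ((by simpa using hN p x : |v p x| ≤ N).trans (le_max_right _ _))
  have := Convex.norm_image_sub_le_of_norm_deriv_le (f := F) (C := |C|)
    (fun y _ => hF.differentiable_infty y) (fun y hy => (hC y hy).trans (le_abs_self C))
    (convex_Icc _ _) hv' hu'
  simp only [Real.norm_eq_abs] at this
  refine this.trans ?_
  rw [mul_assoc]
  exact mul_le_mul_of_nonneg_left (hD p x) (abs_nonneg _)

theorem derivBoundUpTo_comp_sub (hu : IsSmoothO (fun _ => 1) u) (hv : IsSmoothO (fun _ => 1) v)
    (huv : IsSmoothO w fun p x => u p x - v p x) (n : ℕ) :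
    ∀ F : ℝ → ℝ, ContDiff ℝ ∞ F → DerivBoundUpTo n w fun p x => F (u p x) - F (v p x) := by
  induction n with
  | zero => exact fun F hF => derivBoundUpTo_zero.2 (exists_bound_comp_sub hF hu hv huv)
  | succ n ih =>
    intro F hF
    refine derivBoundUpTo_succ.2 ⟨exists_bound_comp_sub hF hu hv huv, ?_⟩
    -- The difference of the two chain rules is split so that each product has a small factor:
    -- either `F' ∘ u - F' ∘ v`, covered by the induction hypothesis for `F'`, or the derivative of
    -- `u - v`.
    have e : (fun p => deriv fun x => F (u p x) - F (v p x)) = fun p x =>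
        (deriv F (u p x) - deriv F (v p x)) * deriv (u p) x
          + deriv F (v p x) * deriv (fun y => u p y - v p y) x := by
      funext p x
      have hu1 := (hu.1 p).differentiable_infty
      have hv1 := (hv.1 p).differentiable_infty
      have hFd := hF.differentiable_infty
      have hFu : Differentiable ℝ fun y => F (u p y) := hFd.comp hu1
      have hFv : Differentiable ℝ fun y => F (v p y) := hFd.comp hv1
      rw [deriv_fun_sub (hFu x) (hFv x), deriv_fun_sub (hu1 x) (hv1 x),
        deriv_comp_infty hF (hu.1 p), deriv_comp_infty hF (hv.1 p)]
      ring
    rw [e]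
    have hF' := hF.deriv_infty
    have h1 := DerivBoundUpTo.mul (fun p => (hF'.comp (hu.1 p)).sub (hF'.comp (hv.1 p)))
      (fun p => (hu.1 p).deriv_infty) (ih _ hF') (hu.deriv.derivBoundUpTo n)
    have h2 := DerivBoundUpTo.mul (fun p => hF'.comp (hv.1 p))
      (fun p => (huv.1 p).deriv_infty) ((hv.comp hF').derivBoundUpTo n)
      (huv.deriv.derivBoundUpTo n)
    simp only [mul_one, one_mul] at h1 h2
    exact h1.add (fun p => ((hF'.comp (hu.1 p)).sub (hF'.comp (hv.1 p))).mul
      (hu.1 p).deriv_infty) (fun p => (hF'.comp (hv.1 p)).mul (huv.1 p).deriv_infty) h2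

/-- Smooth functions are Lipschitz for uniform smooth bounds. -/
theorem IsSmoothO.comp_sub {F : ℝ → ℝ} (hF : ContDiff ℝ ∞ F) (hu : IsSmoothO (fun _ => 1) u)
    (hv : IsSmoothO (fun _ => 1) v) (huv : IsSmoothO w fun p x => u p x - v p x) :
    IsSmoothO w fun p x => F (u p x) - F (v p x) :=
  .of_derivBoundUpTo (fun p => (hF.comp (hu.1 p)).sub (hF.comp (hv.1 p)))
    fun n => derivBoundUpTo_comp_sub hu hv huv n F hF

end Composition

/-! ### Taylor remainders -/

section Taylor

/-- Each use of the mean value inequality gains one power of `|z|`, without the sharp factorial.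
Only the segment from `0` to `y` matters: in time, derivatives are controlled on `[0, T]` alone. -/
theorem abs_le_of_abs_deriv_le_pow {φ φ' : ℝ → ℝ} {y C : ℝ} {n : ℕ} (hC : 0 ≤ C) (h0 : φ 0 = 0)
    (hφ : ∀ z, HasDerivAt φ (φ' z) z) (hb : ∀ z ∈ Set.uIcc 0 y, |φ' z| ≤ C * |z| ^ n) :
    ∀ z ∈ Set.uIcc 0 y, |φ z| ≤ C * |z| ^ (n + 1) := by
  intro z hz
  have hsub : Set.uIcc 0 z ⊆ Set.uIcc 0 y := Set.uIcc_subset_uIcc_left hz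
  have key := (convex_uIcc (0 : ℝ) z).norm_image_sub_le_of_norm_hasDerivWithin_le
    (f := φ) (f' := φ') (C := C * |z| ^ n) (x := 0) (y := z)
    (fun s _ => (hφ s).hasDerivWithinAt) (fun s hs => ?_) Set.left_mem_uIcc Set.right_mem_uIcc
  · simpa [h0, pow_succ, mul_assoc] using key
  · refine (hb s (hsub hs)).trans ?_
    have : |s| ≤ |z| := by simpa using Set.abs_sub_left_of_mem_uIcc hs
    gcongr

/-- First-order Taylor formula with a remainder bound. -/
theorem abs_taylor_one_le {g : ℝ → ℝ} (hg : ContDiff ℝ ∞ g) {x y C : ℝ} (hC : 0 ≤ C)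
    (h : ∀ z ∈ Set.uIcc 0 y, |deriv (deriv g) (x + z)| ≤ C) :
    |g (x + y) - g x - y * deriv g x| ≤ C * |y| ^ 2 := by
  have d : ∀ {G : ℝ → ℝ}, ContDiff ℝ ∞ G → ∀ z,
      HasDerivAt (fun z => G (x + z)) (deriv G (x + z)) z := fun hG z =>
    ((hG.differentiable_infty (x + z)).hasDerivAt).comp_const_add x z
  have h1 := abs_le_of_abs_deriv_le_pow (φ := fun z => deriv g (x + z) - deriv g x)
    (n := 0) hC (by simp) (fun z => (d hg.deriv_infty z).sub_const _) (by simpa using h)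
  have h2 := abs_le_of_abs_deriv_le_pow (φ := fun z => g (x + z) - g x - z * deriv g x)
    (φ' := fun z => deriv g (x + z) - deriv g x) (n := 1) hC (by simp)
    (fun z => ((d hg z).sub_const _).sub (by simpa using (hasDerivAt_id z).mul_const _))
    (by simpa using h1)
  exact h2 y Set.right_mem_uIcc

/-- Second-order Taylor formula with a remainder bound. -/
theorem abs_taylor_two_le {g : ℝ → ℝ} (hg : ContDiff ℝ ∞ g) {C : ℝ} (hC : 0 ≤ C)
    (h : ∀ z, |deriv (deriv (deriv g)) z| ≤ C) (x y : ℝ) :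
    |g (x + y) - g x - y * deriv g x - y ^ 2 / 2 * deriv (deriv g) x| ≤ C * |y| ^ 3 := by
  have d : ∀ z, HasDerivAt (fun z => g (x + z)) (deriv g (x + z)) z := fun z =>
    ((hg.differentiable_infty (x + z)).hasDerivAt).comp_const_add x z
  refine abs_le_of_abs_deriv_le_pow (y := y)
    (φ := fun z => g (x + z) - g x - z * deriv g x - z ^ 2 / 2 * deriv (deriv g) x)
    (φ' := fun z => deriv g (x + z) - deriv g x - z * deriv (deriv g) x) (n := 2) hC (by simp)
    (fun z => ?_) (fun z _ => abs_taylor_one_le hg.deriv_infty hC fun s _ => h _)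
    y Set.right_mem_uIcc
  have h2 : HasDerivAt (fun z : ℝ => z ^ 2 / 2 * deriv (deriv g) x) (z * deriv (deriv g) x) z := by
    have := ((hasDerivAt_pow 2 z).div_const 2).mul_const (deriv (deriv g) x)
    exact this.congr_deriv (by push_cast; ring)
  exact (((d z).sub_const _).sub (by simpa using (hasDerivAt_id z).mul_const _)).sub h2

end Taylor

/-! ### Second-order three-point difference quotients -/

section Stencil

/-- The three-point difference quotient `h⁻¹ ∑ a_j g(x + s_j h)`. -/
def stencil (a s : Fin 3 → ℝ) (h : ℝ) (g : ℝ → ℝ) (x : ℝ) : ℝ :=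
  (∑ j, a j * g (x + s j * h)) / h

/-- Conditions under which a three-point difference quotient is second-order accurate. -/
structure IsSecondOrderStencil (a s : Fin 3 → ℝ) : Prop where
  sum_coeff : ∑ j, a j = 0
  sum_first : ∑ j, a j * s j = 1
  sum_second : ∑ j, a j * s j ^ 2 = 0

variable {a s : Fin 3 → ℝ} {P : Type*} {h w : P → ℝ} {g : P → ℝ → ℝ}

theorem contDiff_stencil {g : ℝ → ℝ} (hg : ContDiff ℝ ∞ g) (h : ℝ) :
    ContDiff ℝ ∞ (stencil a s h g) := by
  unfold stencil
  exact (ContDiff.sum fun j _ => contDiff_const.mul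
    (hg.comp (contDiff_id.add contDiff_const))).div_const h

theorem deriv_stencil {g : ℝ → ℝ} (hg : ContDiff ℝ ∞ g) (h : ℝ) :
    deriv (stencil a s h g) = stencil a s h (deriv g) := by
  funext x
  have : HasDerivAt (stencil a s h g) (stencil a s h (deriv g) x) x := by
    unfold stencil
    exact (HasDerivAt.fun_sum fun j _ => ((hg.differentiable_infty
      (x + s j * h)).hasDerivAt.comp_add_const x (s j * h)).const_mul (a j)).div_const h
  exact this.deriv

/-- Being translation invariant, the quotient commutes with differentiation, so pointwise estimates
give estimates of every derivative. -/
theorem iteratedDeriv_stencil {g : ℝ → ℝ} (hg : ContDiff ℝ ∞ g) (h : ℝ) (n : ℕ) :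
    iteratedDeriv n (stencil a s h g) = stencil a s h (iteratedDeriv n g) := by
  induction n with
  | zero => simp
  | succ n ih => rw [iteratedDeriv_succ, ih, iteratedDeriv_succ,
      deriv_stencil (hg.iteratedDeriv_infty n)]

theorem stencil_sub {f g : ℝ → ℝ} (h x : ℝ) :
    stencil a s h (fun y => f y - g y) x = stencil a s h f x - stencil a s h g x := by
  simp only [stencil, ← sub_div, ← Finset.sum_sub_distrib, mul_sub]

theorem stencil_add {f g : ℝ → ℝ} (h x : ℝ) :
    stencil a s h (fun y => f y + g y) x = stencil a s h f x + stencil a s h g x := by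
  simp only [stencil, ← add_div, ← Finset.sum_add_distrib, mul_add]

theorem stencil_const_mul {g : ℝ → ℝ} (c h x : ℝ) :
    stencil a s h (fun y => c * g y) x = c * stencil a s h g x := by
  simp only [stencil, mul_div_assoc', Finset.mul_sum]
  congr 1
  exact Finset.sum_congr rfl fun j _ => by ring

/-- As the coefficients sum to zero, `g x` can be subtracted from every value; the mean value
inequality then absorbs the division by `h`. -/
theorem abs_stencil_le {g : ℝ → ℝ} (hs : IsSecondOrderStencil a s) (hg : ContDiff ℝ ∞ g) {h C : ℝ}
    (hh : 0 < h) (hC : ∀ x, |deriv g x| ≤ C) (x : ℝ) :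
    |stencil a s h g x| ≤ (∑ j, |a j| * |s j|) * C := by
  have e : stencil a s h g x = (∑ j, a j * (g (x + s j * h) - g x)) / h := by
    simp only [stencil, mul_sub, Finset.sum_sub_distrib, ← Finset.sum_mul, hs.sum_coeff]
    ring
  rw [e, abs_div, abs_of_pos hh, div_le_iff₀ hh, mul_assoc, Finset.sum_mul]
  refine (Finset.abs_sum_le_sum_abs _ _).trans (Finset.sum_le_sum fun j _ => ?_)
  have := Convex.norm_image_sub_le_of_norm_deriv_le (f := g) (C := C) (s := Set.univ)
    (x := x) (y := x + s j * h) (fun y _ => hg.differentiable_infty y) (fun y _ => hC y)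
    convex_univ trivial trivial
  simp only [Real.norm_eq_abs, add_sub_cancel_left, abs_mul, abs_of_pos hh] at this
  rw [abs_mul]
  calc |a j| * |g (x + s j * h) - g x| ≤ |a j| * (C * (|s j| * h)) := by gcongr
    _ = _ := by ring

/-- The three moment conditions remove the constant and quadratic Taylor terms and turn the linear
one into `deriv g x`. What remains is `O(h ^ 3)`, divided by `h`. -/
theorem abs_stencil_sub_deriv_le {g : ℝ → ℝ} (hs : IsSecondOrderStencil a s)
    (hg : ContDiff ℝ ∞ g) {h C : ℝ} (hh : 0 < h) (hC : ∀ x, |deriv (deriv (deriv g)) x| ≤ C)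
    (x : ℝ) :
    |stencil a s h g x - deriv g x| ≤ (∑ j, |a j| * |s j| ^ 3) * (C * h ^ 2) := by
  have hC0 : 0 ≤ C := (abs_nonneg _).trans (hC 0)
  have e : stencil a s h g x - deriv g x = (∑ j, a j * (g (x + s j * h) - g x
      - (s j * h) * deriv g x - (s j * h) ^ 2 / 2 * deriv (deriv g) x)) / h := by
    have e1 : ∑ j, a j * (s j * h * deriv g x) = h * deriv g x := by
      calc _ = (∑ j, a j * s j) * (h * deriv g x) := by
            rw [Finset.sum_mul]; exact Finset.sum_congr rfl fun j _ => by ring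
        _ = _ := by rw [hs.sum_first]; ring
    have e2 : ∑ j, a j * ((s j * h) ^ 2 / 2 * deriv (deriv g) x) = 0 := by
      calc _ = (∑ j, a j * s j ^ 2) * (h ^ 2 / 2 * deriv (deriv g) x) := by
            rw [Finset.sum_mul]; exact Finset.sum_congr rfl fun j _ => by ring
        _ = _ := by rw [hs.sum_second]; ring
    simp only [stencil, mul_sub, Finset.sum_sub_distrib, e1, e2, ← Finset.sum_mul, hs.sum_coeff]
    rw [zero_mul, sub_zero, sub_zero, sub_div, mul_div_cancel_left₀ _ hh.ne']
  rw [e, abs_div, abs_of_pos hh, div_le_iff₀ hh, Finset.sum_mul, Finset.sum_mul]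
  refine (Finset.abs_sum_le_sum_abs _ _).trans (Finset.sum_le_sum fun j _ => ?_)
  rw [abs_mul]
  have := abs_taylor_two_le hg hC0 hC x (s j * h)
  rw [abs_mul, abs_of_pos hh] at this
  calc _ ≤ |a j| * (C * (|s j| * h) ^ 3) := by gcongr
    _ = _ := by ring

theorem IsSmoothO.stencil (hs : IsSecondOrderStencil a s) (hh : ∀ p, 0 < h p)
    (hg : IsSmoothO w g) : IsSmoothO w fun p => stencil a s (h p) (g p) := by
  refine ⟨fun p => contDiff_stencil (hg.1 p) _, fun n => ?_⟩
  obtain ⟨C, hC⟩ := hg.2 (n + 1)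
  refine ⟨(∑ j, |a j| * |s j|) * C, fun p x => ?_⟩
  rw [iteratedDeriv_stencil (hg.1 p), mul_assoc]
  refine abs_stencil_le hs ((hg.1 p).iteratedDeriv_infty n) (hh p) (fun y => ?_) x
  simpa [iteratedDeriv_succ] using hC p y

theorem IsSmoothO.stencil_sub_deriv (hs : IsSecondOrderStencil a s) (hh : ∀ p, 0 < h p)
    (hg : IsSmoothO w g) :
    IsSmoothO (fun p => w p * h p ^ 2)
      fun p x => _root_.stencil a s (h p) (g p) x - deriv (g p) x := by
  refine ⟨fun p => (contDiff_stencil (hg.1 p) _).sub (hg.1 p).deriv_infty, fun n => ?_⟩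
  obtain ⟨C, hC⟩ := hg.2 (n + 3)
  refine ⟨(∑ j, |a j| * |s j| ^ 3) * C, fun p x => ?_⟩
  have e : iteratedDeriv n (fun x => _root_.stencil a s (h p) (g p) x - deriv (g p) x) x
      = _root_.stencil a s (h p) (iteratedDeriv n (g p)) x - deriv (iteratedDeriv n (g p)) x := by
    rw [iteratedDeriv_fun_sub
      ((contDiff_stencil (hg.1 p) _).contDiffAt.of_le (by exact_mod_cast le_top))
      ((hg.1 p).deriv_infty.contDiffAt.of_le (by exact_mod_cast le_top)),
      iteratedDeriv_stencil (hg.1 p), ← iteratedDeriv_succ', iteratedDeriv_succ]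
  rw [e, mul_assoc, ← mul_assoc C]
  refine abs_stencil_sub_deriv_le hs ((hg.1 p).iteratedDeriv_infty n) (hh p) (fun y => ?_) x
  simpa [iteratedDeriv_succ] using hC p y

end Stencil

end

/-! ### The scheme acting on functions of a continuous variable -/

noncomputable section

/-- The third node has weight zero; it only gives the centered quotient the same three-point format
as the upwind one. -/
def centeredCoeff : Fin 3 → ℝ := ![1 / 2, -1 / 2, 0]

def centeredNode : Fin 3 → ℝ := ![1, -1, 0]

def upwindCoeff (γ : ℝ) : Fin 3 → ℝ := if 0 < γ then ![3 / 2, -2, 1 / 2] else ![-3 / 2, 2, -1 / 2]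

def upwindNode (γ : ℝ) : Fin 3 → ℝ := if 0 < γ then ![0, -1, -2] else ![0, 1, 2]

theorem isSecondOrderStencil_centered : IsSecondOrderStencil centeredCoeff centeredNode := by
  constructor <;> simp [centeredCoeff, centeredNode, Fin.sum_univ_three] <;> norm_num

theorem isSecondOrderStencil_upwind (γ : ℝ) :
    IsSecondOrderStencil (upwindCoeff γ) (upwindNode γ) := by
  by_cases hγ : 0 < γ <;> constructor <;>
    simp [upwindCoeff, upwindNode, hγ, Fin.sum_univ_three] <;> norm_num

theorem upwindFlux_sub_sampleAt (γ x₀ h : ℝ) (g : ℝ → ℝ) (i : ℤ) :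
    (upwindFlux γ (sampleAt x₀ h g) i - upwindFlux γ (sampleAt x₀ h g) (i - 1)) / h
      = γ * stencil (upwindCoeff γ) (upwindNode γ) h g (x₀ + i * h) := by
  by_cases hγ : 0 < γ
  · have e1 : x₀ + ((i : ℝ) - 1) * h = x₀ + i * h + -h := by ring
    have e2 : x₀ + ((i : ℝ) - 1 - 1) * h = x₀ + i * h + -(2 * h) := by ring
    simp [upwindFlux, upwindCoeff, upwindNode, hγ, sampleAt, stencil, Fin.sum_univ_three, e1, e2]
    ring
  · have e1 : x₀ + ((i : ℝ) + 1) * h = x₀ + i * h + h := by ring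
    have e2 : x₀ + ((i : ℝ) + 2) * h = x₀ + i * h + 2 * h := by ring
    have e3 : x₀ + ((i : ℝ) - 1 + 2) * h = x₀ + i * h + h := by ring
    simp [upwindFlux, upwindCoeff, upwindNode, hγ, sampleAt, stencil, Fin.sum_univ_three, e1, e2,
      e3]
    ring

theorem centeredFlux_sub_sampleAt (γ x₀ h : ℝ) (g : ℝ → ℝ) (i : ℤ) :
    (centeredFlux γ (sampleAt x₀ h g) i - centeredFlux γ (sampleAt x₀ h g) (i - 1)) / h
      = γ * stencil centeredCoeff centeredNode h g (x₀ + i * h) := by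
  have e1 : x₀ + ((i : ℝ) - 1) * h = x₀ + i * h + -h := by ring
  have e2 : x₀ + ((i : ℝ) + 1) * h = x₀ + i * h + h := by ring
  simp [centeredFlux, centeredCoeff, centeredNode, sampleAt, stencil, Fin.sum_univ_three, e1, e2]
  ring

namespace KineticModel

variable {J : ℕ} (m : KineticModel J)

/-- The speed of the diffusive components. -/
def diffSpeed (ε : ℝ) : ℝ := m.mu / √2 + m.theta / √ε

theorem diffSpeed_mul_sqrt {ε : ℝ} (hε : 0 < ε) :
    m.diffSpeed ε * √ε = m.mu / √2 * √ε + m.theta := by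
  have : √ε ≠ 0 := (Real.sqrt_pos.2 hε).ne'
  rw [diffSpeed, add_mul, div_mul_cancel₀ _ this]

theorem diffSpeed_nonneg (ε : ℝ) : 0 ≤ m.diffSpeed ε := by
  have := m.mu_nonneg
  have := m.theta_pos
  unfold diffSpeed
  positivity

/-- The diffusive scaling: the speed grows no faster than `ε ^ (-1/2)`. All bounds on `ε c` and `ε
c²` derive from this one. -/
theorem diffSpeed_mul_sqrt_le {ε : ℝ} (hε : 0 < ε) (hε1 : ε ≤ 1) :
    m.diffSpeed ε * √ε ≤ m.mu + m.theta := by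
  rw [m.diffSpeed_mul_sqrt hε]
  have h1 : √ε ≤ 1 := Real.sqrt_le_one.2 hε1
  have h2 : m.mu / √2 ≤ m.mu :=
    div_le_self m.mu_nonneg (Real.one_le_sqrt.2 one_le_two)
  have h3 : 0 ≤ m.mu / √2 := div_nonneg m.mu_nonneg (Real.sqrt_nonneg _)
  nlinarith

theorem mul_diffSpeed_sq_le {ε : ℝ} (hε : 0 < ε) (hε1 : ε ≤ 1) :
    ε * m.diffSpeed ε ^ 2 ≤ (m.mu + m.theta) ^ 2 := by
  have h := m.diffSpeed_mul_sqrt_le hε hε1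
  have e : ε * m.diffSpeed ε ^ 2 = (m.diffSpeed ε * √ε) ^ 2 := by
    rw [mul_pow, Real.sq_sqrt hε.le]; ring
  rw [e]
  exact pow_le_pow_left₀ (mul_nonneg (m.diffSpeed_nonneg _) (Real.sqrt_nonneg _)) h 2

theorem sum_maxwellian (w : ℝ) : ∑ l, m.maxwellian l w = w := by
  have := m.sum_maxw w
  have h := m.theta_pos.ne'
  simp only [maxwellian, Fintype.sum_sum_type, Sum.elim_inl, Sum.elim_inr, Fin.sum_univ_two]
  rw [← this]
  congr 1
  · simp [this]
  · rw [this]; field_simp; ring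

theorem velocity_inr_zero (ε : ℝ) : m.velocity ε (Sum.inr 0) = -m.diffSpeed ε := by
  simp [velocity, diffSpeed]

theorem velocity_inr_one (ε : ℝ) : m.velocity ε (Sum.inr 1) = m.diffSpeed ε := by
  simp [velocity, diffSpeed]

/-- The discretized convective derivative acting on functions of a continuous variable. -/
def convectionFn (ε h : ℝ) (f : Fin J ⊕ Fin 2 → ℝ → ℝ) : Fin J ⊕ Fin 2 → ℝ → ℝ :=
  Sum.elim
    (fun l x => m.lam l *
      stencil (upwindCoeff (m.lam l)) (upwindNode (m.lam l)) h (f (Sum.inl l)) x)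
    (fun k x => m.velocity ε (Sum.inr k) *
      stencil centeredCoeff centeredNode h (f (Sum.inr k)) x)

/-- The inner step with `δt = ε` acting on functions of a continuous variable. -/
def innerStepFn (ε h : ℝ) (f : Fin J ⊕ Fin 2 → ℝ → ℝ) : Fin J ⊕ Fin 2 → ℝ → ℝ :=
  fun l x => m.maxwellian l (∑ k, f k x) - ε * m.convectionFn ε h f l x

/-- The scheme is translation invariant, so it commutes with sampling. The analysis can therefore
stay with smooth functions and evaluate at nodes only at the end. -/
theorem convection_sampleAt (ε h x₀ : ℝ) (f : Fin J ⊕ Fin 2 → ℝ → ℝ) :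
    m.convection ε h (fun l => sampleAt x₀ h (f l))
      = fun l => sampleAt x₀ h (m.convectionFn ε h f l) := by
  funext l i
  rcases l with l | k
  · exact upwindFlux_sub_sampleAt _ _ _ _ _
  · exact centeredFlux_sub_sampleAt _ _ _ _ _

/-- The choice `δt = ε` cancels `f l i` exactly. -/
theorem innerStep_self {ε : ℝ} (hε : 0 < ε) (h : ℝ) (f : KineticGrid J) (l : Fin J ⊕ Fin 2)
    (i : ℤ) :
    m.innerStep ε ε h f l i = m.maxwellian l (gridDensity f i) - ε * m.convection ε h f l i := by
  simp only [innerStep]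
  field_simp
  ring

theorem innerStep_sampleAt {ε : ℝ} (hε : 0 < ε) (h x₀ : ℝ) (f : Fin J ⊕ Fin 2 → ℝ → ℝ) :
    m.innerStep ε ε h (fun l => sampleAt x₀ h (f l))
      = fun l => sampleAt x₀ h (m.innerStepFn ε h f l) := by
  funext l i
  rw [m.innerStep_self hε, convection_sampleAt]
  rfl

theorem innerStep_iterate_sampleAt {ε : ℝ} (hε : 0 < ε) (h x₀ : ℝ) (f : Fin J ⊕ Fin 2 → ℝ → ℝ)
    (k : ℕ) :
    (m.innerStep ε ε h)^[k] (fun l => sampleAt x₀ h (f l))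
      = fun l => sampleAt x₀ h ((m.innerStepFn ε h)^[k] f l) := by
  induction k with
  | zero => rfl
  | succ k ih => rw [Function.iterate_succ_apply', ih, m.innerStep_sampleAt hε,
      Function.iterate_succ_apply']

theorem gridDensity_pfeStep (K : ℕ) (ε δt Δt h : ℝ) (f : KineticGrid J) (i : ℤ) :
    gridDensity (m.pfeStep K ε δt Δt h f) i =
      gridDensity ((m.innerStep ε δt h)^[K + 1] f) i + (Δt - (K + 1) * δt) *
        ((gridDensity ((m.innerStep ε δt h)^[K + 1] f) i
          - gridDensity ((m.innerStep ε δt h)^[K] f) i) / δt) := by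
  simp only [gridDensity, pfeStep, Finset.sum_add_distrib, ← Finset.mul_sum, ← Finset.sum_div,
    Finset.sum_sub_distrib]

theorem gridDensity_innerStep {ε : ℝ} (hε : 0 < ε) (h : ℝ) (f : KineticGrid J) (i : ℤ) :
    gridDensity (m.innerStep ε ε h f) i
      = gridDensity f i - ε * ∑ l, m.convection ε h f l i := by
  have : gridDensity (m.innerStep ε ε h f) i = ∑ l, m.innerStep ε ε h f l i := rfl
  simp only [this, m.innerStep_self hε, Finset.sum_sub_distrib, m.sum_maxwellian,
    ← Finset.mul_sum]

theorem sum_innerStepFn (ε h : ℝ) (f : Fin J ⊕ Fin 2 → ℝ → ℝ) (x : ℝ) :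
    ∑ l, m.innerStepFn ε h f l x = ∑ l, f l x - ε * ∑ l, m.convectionFn ε h f l x := by
  simp only [innerStepFn, Finset.sum_sub_distrib, m.sum_maxwellian, ← Finset.mul_sum]

/-- The diffusive components share one linear stencil and have opposite velocities, so the density
only sees the flux `c d`, which stays bounded although `c` does not. -/
theorem sum_convectionFn (ε h : ℝ) (f : Fin J ⊕ Fin 2 → ℝ → ℝ) (x : ℝ) :
    ∑ l, m.convectionFn ε h f l x =
      ∑ l, m.lam l * stencil (upwindCoeff (m.lam l)) (upwindNode (m.lam l)) h (f (Sum.inl l)) x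
      + stencil centeredCoeff centeredNode h
          (fun y => m.diffSpeed ε * (f (Sum.inr 1) y - f (Sum.inr 0) y)) x := by
  rw [stencil_const_mul, stencil_sub]
  simp only [convectionFn, Fintype.sum_sum_type, Sum.elim_inl, Sum.elim_inr, Fin.sum_univ_two,
    velocity_inr_zero, velocity_inr_one]
  ring

/-- The increment of the projective step is the last inner rate up to the defects of the inner
rates. -/
theorem gridDensity_pfeStep_sampleAt {ε Δt : ℝ} (hε : 0 < ε) (K : ℕ) (h x₀ : ℝ)
    (f : Fin J ⊕ Fin 2 → ℝ → ℝ) (i : ℤ) :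
    gridDensity (m.pfeStep K ε ε Δt h fun l => sampleAt x₀ h (f l)) i =
      ∑ l, f l (x₀ + i * h)
        - ε * ∑ k ∈ Finset.range (K + 1),
            ∑ l, m.convectionFn ε h ((m.innerStepFn ε h)^[k] f) l (x₀ + i * h)
        - (Δt - (K + 1) * ε) *
            ∑ l, m.convectionFn ε h ((m.innerStepFn ε h)^[K] f) l (x₀ + i * h) := by
  have hd : ∀ k : ℕ, gridDensity ((m.innerStep ε ε h)^[k] fun l => sampleAt x₀ h (f l)) i
      = ∑ l, (m.innerStepFn ε h)^[k] f l (x₀ + i * h) := by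
    intro k
    rw [m.innerStep_iterate_sampleAt hε]
    rfl
  have hs : ∀ k : ℕ, ∑ l, (m.innerStepFn ε h)^[k + 1] f l (x₀ + i * h)
      = ∑ l, (m.innerStepFn ε h)^[k] f l (x₀ + i * h)
        - ε * ∑ l, m.convectionFn ε h ((m.innerStepFn ε h)^[k] f) l (x₀ + i * h) := by
    intro k
    rw [Function.iterate_succ_apply', sum_innerStepFn]
  have ht : ∀ k : ℕ, ∑ l, (m.innerStepFn ε h)^[k] f l (x₀ + i * h)
      = ∑ l, f l (x₀ + i * h) - ε * ∑ j ∈ Finset.range k,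
          ∑ l, m.convectionFn ε h ((m.innerStepFn ε h)^[j] f) l (x₀ + i * h) := by
    intro k
    induction k with
    | zero => simp
    | succ k ih => rw [hs, ih, Finset.sum_range_succ]; ring
  rw [gridDensity_pfeStep, hd, hd, ht (K + 1), ht K, Finset.sum_range_succ]
  field_simp
  ring

theorem deriv_A_comp {u : ℝ → ℝ} (hu : ContDiff ℝ ∞ u) (x : ℝ) :
    deriv (fun y => m.A (u y)) x = ∑ l, m.lam l * deriv (fun y => m.maxw l (u y)) x := by
  have e : (fun y => m.A (u y)) = fun y => ∑ l, m.lam l * m.maxw l (u y) := by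
    funext y; exact (m.sum_lam_maxw _).symm
  rw [e]
  exact (HasDerivAt.fun_sum fun l _ => (((m.smooth_maxw l).comp hu).differentiable_infty
    x).hasDerivAt.const_mul (m.lam l)).deriv

end KineticModel

/-! ### Well-prepared states and their invariance under inner steps -/

section Core

variable {J : ℕ} (m : KineticModel J) {P : Type*}

/-- Kinetic states `f p` close to the local equilibrium of density `u p`, with a flux close to the
diffusive one. -/
structure IsWellPrepared (ε h : P → ℝ) (u : P → ℝ → ℝ) (f : P → Fin J ⊕ Fin 2 → ℝ → ℝ) :
    Prop where
  density : IsSmoothO ε fun p x => ∑ l, f p l x - u p x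
  transport : ∀ l, IsSmoothO ε fun p x => f p (Sum.inl l) x - m.maxw l (u p x)
  diffusive_sum : IsSmoothO ε fun p x =>
    f p (Sum.inr 0) x + f p (Sum.inr 1) x - m.B (u p x) / m.theta ^ 2
  diffusive_flux : IsSmoothO (fun p => ε p + h p ^ 2) fun p x =>
    m.diffSpeed (ε p) * (f p (Sum.inr 1) x - f p (Sum.inr 0) x)
      + ε p * m.diffSpeed (ε p) ^ 2 / m.theta ^ 2 * deriv (fun y => m.B (u p y)) x

variable {m} {ε h : P → ℝ} {u : P → ℝ → ℝ} {f : P → Fin J ⊕ Fin 2 → ℝ → ℝ}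

/-- The coefficient `ε c²/θ²` lies between `0` and `(μ + θ)²/θ²`, so multiplying by it costs no
weight. -/
theorem IsSmoothO.diffusionFlux (hε : ∀ p, 0 < ε p) (hε1 : ∀ p, ε p ≤ 1)
    {w : P → ℝ} {g : P → ℝ → ℝ} (hg : IsSmoothO w g) :
    IsSmoothO w fun p x => ε p * m.diffSpeed (ε p) ^ 2 / m.theta ^ 2 * g p x := by
  refine ⟨fun p => contDiff_const.mul (hg.1 p), fun n => ?_⟩
  obtain ⟨C, hC⟩ := hg.2 n
  refine ⟨(m.mu + m.theta) ^ 2 / m.theta ^ 2 * C, fun p x => ?_⟩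
  have e : iteratedDeriv n (fun x => ε p * m.diffSpeed (ε p) ^ 2 / m.theta ^ 2 * g p x) x
      = ε p * m.diffSpeed (ε p) ^ 2 / m.theta ^ 2 * iteratedDeriv n (g p) x :=
    iteratedDeriv_const_mul_field _ _
  have h0 : 0 ≤ ε p * m.diffSpeed (ε p) ^ 2 / m.theta ^ 2 := by
    have := hε p
    positivity
  rw [e, abs_mul, mul_assoc, abs_of_nonneg h0]
  refine mul_le_mul ?_ (hC p x) (abs_nonneg _) (by positivity)
  have := m.mul_diffSpeed_sq_le (hε p) (hε1 p)
  gcongr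

theorem IsSmoothO.of_eps (hε : ∀ p, 0 < ε p) (hε1 : ∀ p, ε p ≤ 1) {g : P → ℝ → ℝ}
    (hg : IsSmoothO ε g) : IsSmoothO (fun _ => 1) g :=
  hg.mono 1 fun p => by simpa [abs_of_pos (hε p)] using hε1 p

theorem IsSmoothO.eps_mul (hε : ∀ p, 0 < ε p) {g : P → ℝ → ℝ} (hg : IsSmoothO (fun _ => 1) g) :
    IsSmoothO ε fun p x => ε p * g p x :=
  hg.const_mul_of_le ε 1 fun p => by simp [abs_of_pos (hε p)]

theorem IsSmoothO.of_eps_to_sum (hε : ∀ p, 0 < ε p) {g : P → ℝ → ℝ} (hg : IsSmoothO ε g) :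
    IsSmoothO (fun p => ε p + h p ^ 2) g :=
  hg.mono 1 fun p => by simp [abs_of_pos (hε p), sq_nonneg]

theorem IsSmoothO.of_sq_to_sum (hε : ∀ p, 0 < ε p) {g : P → ℝ → ℝ}
    (hg : IsSmoothO (fun p => h p ^ 2) g) : IsSmoothO (fun p => ε p + h p ^ 2) g :=
  hg.mono 1 fun p => by simp [(hε p).le]

theorem IsSmoothO.of_sum {H : ℝ} (hε : ∀ p, 0 < ε p) (hε1 : ∀ p, ε p ≤ 1)
    (hH : ∀ p, h p ^ 2 ≤ H) {g : P → ℝ → ℝ} (hg : IsSmoothO (fun p => ε p + h p ^ 2) g) :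
    IsSmoothO (fun _ => 1) g :=
  hg.mono (1 + H) fun p => by
    have : 0 ≤ ε p + h p ^ 2 := by have := hε p; positivity
    rw [abs_of_nonneg this]
    linarith [hε1 p, hH p]

theorem IsSmoothO.transport (hu : IsSmoothO (fun _ => 1) u) (l : Fin J) :
    IsSmoothO (fun _ => 1) fun p x => m.maxw l (u p x) := hu.comp (m.smooth_maxw l)

theorem IsSmoothO.equilibriumFlux (hε : ∀ p, 0 < ε p) (hε1 : ∀ p, ε p ≤ 1)
    (hu : IsSmoothO (fun _ => 1) u) :
    IsSmoothO (fun _ => 1) fun p x =>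
      ε p * m.diffSpeed (ε p) ^ 2 / m.theta ^ 2 * deriv (fun y => m.B (u p y)) x :=
  .diffusionFlux hε hε1 (hu.comp m.smooth_B).deriv

theorem IsWellPrepared.isSmoothO_density (hε : ∀ p, 0 < ε p) (hε1 : ∀ p, ε p ≤ 1)
    (hu : IsSmoothO (fun _ => 1) u) (hf : IsWellPrepared m ε h u f) :
    IsSmoothO (fun _ => 1) fun p x => ∑ l, f p l x :=
  ((hf.density.of_eps hε hε1).add hu).congr fun p x => by ring

theorem IsWellPrepared.isSmoothO_transport (hε : ∀ p, 0 < ε p) (hε1 : ∀ p, ε p ≤ 1)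
    (hu : IsSmoothO (fun _ => 1) u) (hf : IsWellPrepared m ε h u f) (l : Fin J) :
    IsSmoothO (fun _ => 1) fun p => f p (Sum.inl l) :=
  (((hf.transport l).of_eps hε hε1).add (hu.transport (m := m) l)).congr fun p x => by ring

theorem IsWellPrepared.isSmoothO_flux {H : ℝ} (hε : ∀ p, 0 < ε p) (hε1 : ∀ p, ε p ≤ 1)
    (hH : ∀ p, h p ^ 2 ≤ H) (hu : IsSmoothO (fun _ => 1) u) (hf : IsWellPrepared m ε h u f) :
    IsSmoothO (fun _ => 1) fun p x =>
      m.diffSpeed (ε p) * (f p (Sum.inr 1) x - f p (Sum.inr 0) x) :=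
  ((hf.diffusive_flux.of_sum hε hε1 hH).sub (hu.equilibriumFlux (m := m) hε hε1)).congr
    fun p x => by ring

/-- The summed rate is `O(1)`, so the density moves by `O(ε)` and stays close to the fixed `u`; the
Lipschitz estimate carries this over to the Maxwellians. In the sum of the diffusive components
convection contributes `ε` times the quotient of the bounded flux `c d`. The new flux depends only
on the old sum. -/
theorem IsWellPrepared.innerStepFn {H : ℝ} (hε : ∀ p, 0 < ε p) (hε1 : ∀ p, ε p ≤ 1)
    (hh : ∀ p, 0 < h p) (hH : ∀ p, h p ^ 2 ≤ H) (hu : IsSmoothO (fun _ => 1) u)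
    (hf : IsWellPrepared m ε h u f) :
    IsWellPrepared m ε h u fun p => m.innerStepFn (ε p) (h p) (f p) := by
  have hc := isSecondOrderStencil_centered
  have hdens := hf.isSmoothO_density hε hε1 hu
  have htr := hf.isSmoothO_transport hε hε1 hu
  have hflux := hf.isSmoothO_flux hε hε1 hH hu
  have hθ := m.theta_pos.ne'
  have ht : ∀ l : Fin J, IsSmoothO (fun _ => 1) fun p x => m.lam l * stencil (upwindCoeff (m.lam l))
      (upwindNode (m.lam l)) (h p) (f p (Sum.inl l)) x := fun l =>
    ((htr l).stencil (isSecondOrderStencil_upwind _) hh).const_mul _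
  have hB0 : IsSmoothO (fun _ => 1) fun p x => m.B (u p x) := hu.comp m.smooth_B
  refine ⟨?_, fun l => ?_, ?_, ?_⟩
  · have hS : IsSmoothO (fun _ => 1) fun p x => ∑ l, m.convectionFn (ε p) (h p) (f p) l x :=
      ((IsSmoothO.sum Finset.univ fun l _ => ht l).add (hflux.stencil hc hh)).congr fun p x =>
        m.sum_convectionFn _ _ _ _
    refine (hf.density.sub (hS.eps_mul hε)).congr fun p x => ?_
    rw [m.sum_innerStepFn]; ring
  · refine ((hdens.comp_sub (m.smooth_maxw l) hu hf.density).sub ((ht l).eps_mul hε)).congr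
      fun p x => ?_
    simp only [KineticModel.innerStepFn, KineticModel.maxwellian, KineticModel.convectionFn,
      Sum.elim_inl]
    ring
  · refine (((hdens.comp_sub m.smooth_B hu hf.density).const_mul (1 / m.theta ^ 2)).sub
      ((hflux.stencil hc hh).eps_mul hε)).congr fun p x => ?_
    rw [stencil_const_mul, stencil_sub]
    simp only [KineticModel.innerStepFn, KineticModel.maxwellian, KineticModel.convectionFn,
      Sum.elim_inr, m.velocity_inr_zero, m.velocity_inr_one]
    field_simp
    ring
  -- The equal Maxwellians cancel in the difference, so the new flux is exactly `-ε c² D s`.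
  -- Replacing `s` by `B(u)/θ²` costs `O(ε)`, and replacing `D` by the derivative costs `O(h²)`.
  · have h1 : IsSmoothO (fun p => ε p + h p ^ 2) fun p x =>
        stencil centeredCoeff centeredNode (h p) (fun y => m.B (u p y)) x
          - deriv (fun y => m.B (u p y)) x :=
      ((hB0.stencil_sub_deriv hc hh).mono 1 fun p => by simp).of_sq_to_sum hε
    have h2 := (hf.diffusive_sum.stencil hc hh).const_mul (m.theta ^ 2)
    refine ((h1.add (h2.of_eps_to_sum hε)).neg.diffusionFlux (m := m) hε hε1).congr fun p x => ?_
    have e : stencil centeredCoeff centeredNode (h p)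
        (fun x => f p (Sum.inr 0) x + f p (Sum.inr 1) x - m.B (u p x) / m.theta ^ 2) x
        = stencil centeredCoeff centeredNode (h p) (f p (Sum.inr 0)) x
          + stencil centeredCoeff centeredNode (h p) (f p (Sum.inr 1)) x
          - 1 / m.theta ^ 2 * stencil centeredCoeff centeredNode (h p)
            (fun y => m.B (u p y)) x := by
      rw [stencil_sub, stencil_add, ← stencil_const_mul]
      congr 2
      funext y; ring
    rw [e]
    simp only [KineticModel.innerStepFn, KineticModel.maxwellian, KineticModel.convectionFn,
      Sum.elim_inr, m.velocity_inr_zero, m.velocity_inr_one]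
    field_simp
    ring

theorem IsWellPrepared.innerStepFn_iterate {H : ℝ} (hε : ∀ p, 0 < ε p) (hε1 : ∀ p, ε p ≤ 1)
    (hh : ∀ p, 0 < h p) (hH : ∀ p, h p ^ 2 ≤ H) (hu : IsSmoothO (fun _ => 1) u)
    (hf : IsWellPrepared m ε h u f) (k : ℕ) :
    IsWellPrepared m ε h u fun p => (m.innerStepFn (ε p) (h p))^[k] (f p) := by
  induction k with
  | zero => exact hf
  | succ k ih =>
    simp only [Function.iterate_succ_apply']
    exact ih.innerStepFn hε hε1 hh hH hu

/-- The discretized convective rate of change of a well-prepared state. -/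
theorem IsWellPrepared.isSmoothO_rate (hε : ∀ p, 0 < ε p) (hε1 : ∀ p, ε p ≤ 1)
    (hh : ∀ p, 0 < h p) (hu : IsSmoothO (fun _ => 1) u) (hf : IsWellPrepared m ε h u f) :
    IsSmoothO (fun p => ε p + h p ^ 2) fun p x => ∑ l, m.convectionFn (ε p) (h p) (f p) l x
      - (deriv (fun y => m.A (u p y)) x - ε p * m.diffSpeed (ε p) ^ 2 / m.theta ^ 2 *
          iteratedDeriv 2 (fun y => m.B (u p y)) x) := by
  have hc := isSecondOrderStencil_centered
  have ht : ∀ l : Fin J, IsSmoothO (fun p => ε p + h p ^ 2) fun p x =>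
      m.lam l * (stencil (upwindCoeff (m.lam l)) (upwindNode (m.lam l)) (h p)
          (fun x => f p (Sum.inl l) x - m.maxw l (u p x)) x
        + (stencil (upwindCoeff (m.lam l)) (upwindNode (m.lam l)) (h p)
          (fun x => m.maxw l (u p x)) x - deriv (fun x => m.maxw l (u p x)) x)) := fun l =>
    ((((hf.transport l).stencil (isSecondOrderStencil_upwind _) hh).of_eps_to_sum hε).add
      ((((hu.transport (m := m) l).stencil_sub_deriv (isSecondOrderStencil_upwind _) hh).mono 1
        fun p => by simp).of_sq_to_sum hε)).const_mul _
  have hB : IsSmoothO (fun _ => 1) fun p x => deriv (fun y => m.B (u p y)) x :=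
    (hu.comp m.smooth_B).deriv
  have h1 : IsSmoothO (fun p => ε p + h p ^ 2) fun p x =>
      ε p * m.diffSpeed (ε p) ^ 2 / m.theta ^ 2 *
        (stencil centeredCoeff centeredNode (h p) (deriv fun y => m.B (u p y)) x
          - deriv (deriv fun y => m.B (u p y)) x) :=
    (((hB.stencil_sub_deriv hc hh).mono 1 fun p => by simp).of_sq_to_sum hε).diffusionFlux hε hε1
  refine (((IsSmoothO.sum Finset.univ fun l _ => ht l).add
    (hf.diffusive_flux.stencil hc hh)).sub h1).congr fun p x => ?_
  rw [m.sum_convectionFn, m.deriv_A_comp (hu.1 p), stencil_add, stencil_const_mul (g := deriv _)]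
  simp only [stencil_sub, sub_add_sub_cancel, mul_sub, Finset.sum_sub_distrib, iteratedDeriv_succ,
    iteratedDeriv_zero]
  ring

end Core

end

noncomputable section

/-! ### Functions of space and time with bounded derivatives -/

section Partial

/-- The derivative of a function of `(x, t)` in the direction `v`. -/
def partialDeriv (v : ℝ × ℝ) (w : ℝ → ℝ → ℝ) (x t : ℝ) : ℝ :=
  fderiv ℝ (fun p : ℝ × ℝ => w p.1 p.2) (x, t) v

variable {w : ℝ → ℝ → ℝ} {T : ℝ} {R : ℕ → ℝ}

theorem ContDiff.partialDeriv (hw : ContDiff ℝ ∞ fun p : ℝ × ℝ => w p.1 p.2) (v : ℝ × ℝ) :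
    ContDiff ℝ ∞ fun p : ℝ × ℝ => partialDeriv v w p.1 p.2 :=
  (hw.fderiv_right (m := ∞) (by simp)).clm_apply contDiff_const

theorem hasDerivAt_space (hw : ContDiff ℝ ∞ fun p : ℝ × ℝ => w p.1 p.2) (x t : ℝ) :
    HasDerivAt (fun y => w y t) (partialDeriv (1, 0) w x t) x :=
  HasFDerivAt.comp_hasDerivAt (f := fun y : ℝ => (y, t)) x
    (hw.differentiable_infty (x, t)).hasFDerivAt
    ((hasDerivAt_id x).prodMk (hasDerivAt_const x t))

theorem hasDerivAt_time (hw : ContDiff ℝ ∞ fun p : ℝ × ℝ => w p.1 p.2) (x t : ℝ) :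
    HasDerivAt (fun s => w x s) (partialDeriv (0, 1) w x t) t :=
  HasFDerivAt.comp_hasDerivAt (f := fun s : ℝ => (x, s)) t
    (hw.differentiable_infty (x, t)).hasFDerivAt
    ((hasDerivAt_const t x).prodMk (hasDerivAt_id t))

theorem contDiff_space (hw : ContDiff ℝ ∞ fun p : ℝ × ℝ => w p.1 p.2) (t : ℝ) :
    ContDiff ℝ ∞ fun y => w y t :=
  hw.comp (contDiff_id.prodMk contDiff_const)

theorem contDiff_time (hw : ContDiff ℝ ∞ fun p : ℝ × ℝ => w p.1 p.2) (x : ℝ) :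
    ContDiff ℝ ∞ fun s => w x s :=
  hw.comp (contDiff_const.prodMk contDiff_id)

theorem HasDerivBounds.partialDeriv (hw : ContDiff ℝ ∞ fun p : ℝ × ℝ => w p.1 p.2)
    (hb : HasDerivBounds T R w) {v : ℝ × ℝ} (hv : ‖v‖ ≤ 1) :
    HasDerivBounds T (fun n => R (n + 1)) (partialDeriv v w) := by
  intro n x t h0 h1
  refine le_trans ?_ (hb (n + 1) x t h0 h1)
  have e : (fun p : ℝ × ℝ => _root_.partialDeriv v w p.1 p.2)
      = ContinuousLinearMap.apply ℝ ℝ v ∘ fderiv ℝ (fun p : ℝ × ℝ => w p.1 p.2) := rfl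
  have hd : ContDiff ℝ ∞ (fderiv ℝ fun p : ℝ × ℝ => w p.1 p.2) := hw.fderiv_right (by simp)
  rw [e, ← norm_iteratedFDeriv_fderiv]
  refine (ContinuousLinearMap.norm_iteratedFDeriv_comp_left _ hd.contDiffAt
    (by exact_mod_cast le_top)).trans ?_
  refine mul_le_of_le_one_left (norm_nonneg _) ?_
  refine ContinuousLinearMap.opNorm_le_bound _ zero_le_one fun L => ?_
  rw [one_mul, ContinuousLinearMap.apply_apply]
  exact (L.le_opNorm v).trans (mul_le_of_le_one_right (norm_nonneg _) hv)

theorem HasDerivBounds.space (hw : ContDiff ℝ ∞ fun p : ℝ × ℝ => w p.1 p.2)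
    (hb : HasDerivBounds T R w) :
    HasDerivBounds T (fun n => R (n + 1)) (_root_.partialDeriv (1, 0) w) :=
  hb.partialDeriv hw (by simp)

theorem HasDerivBounds.time (hw : ContDiff ℝ ∞ fun p : ℝ × ℝ => w p.1 p.2)
    (hb : HasDerivBounds T R w) :
    HasDerivBounds T (fun n => R (n + 1)) (_root_.partialDeriv (0, 1) w) :=
  hb.partialDeriv hw (by simp)

theorem HasDerivBounds.abs_le (hb : HasDerivBounds T R w) {x t : ℝ} (h0 : 0 ≤ t) (h1 : t ≤ T) :
    |w x t| ≤ R 0 := by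
  simpa using hb 0 x t h0 h1

theorem HasDerivBounds.abs_iteratedDeriv_le (hw : ContDiff ℝ ∞ fun p : ℝ × ℝ => w p.1 p.2)
    (hb : HasDerivBounds T R w) {t : ℝ} (h0 : 0 ≤ t) (h1 : t ≤ T) (n : ℕ) (x : ℝ) :
    |iteratedDeriv n (fun y => w y t) x| ≤ R n := by
  induction n generalizing w R with
  | zero => simpa using hb.abs_le h0 h1
  | succ n ih =>
    have e : deriv (fun y => w y t) = fun y => _root_.partialDeriv (1, 0) w y t := by
      funext y; exact (hasDerivAt_space hw y t).deriv
    rw [iteratedDeriv_succ', e]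
    exact ih (hw.partialDeriv _) (hb.space hw)

theorem isSmoothO_of_hasDerivBounds {P : Type*} {w : P → ℝ → ℝ → ℝ} {t : P → ℝ}
    (hw : ∀ p, ContDiff ℝ ∞ fun q : ℝ × ℝ => w p q.1 q.2) (hb : ∀ p, HasDerivBounds T R (w p))
    (h0 : ∀ p, 0 ≤ t p) (h1 : ∀ p, t p ≤ T) :
    IsSmoothO (fun _ => 1) fun p x => w p x (t p) :=
  ⟨fun p => contDiff_space (hw p) _, fun n =>
    ⟨R n, fun p x => by simpa using (hb p).abs_iteratedDeriv_le (hw p) (h0 p) (h1 p) n x⟩⟩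

/-- First-order Taylor expansion in time. -/
theorem HasDerivBounds.abs_time_taylor_le (hw : ContDiff ℝ ∞ fun p : ℝ × ℝ => w p.1 p.2)
    (hb : HasDerivBounds T R w) {t s : ℝ} (h0 : 0 ≤ t) (hs : 0 < s) (h1 : t + s ≤ T) (x : ℝ) :
    |(w x (t + s) - w x t) / s - _root_.partialDeriv (0, 1) w x t| ≤ R 2 * s := by
  have e : ∀ {v : ℝ → ℝ → ℝ}, (ContDiff ℝ ∞ fun p : ℝ × ℝ => v p.1 p.2) →
      deriv (fun s => v x s) = fun s => _root_.partialDeriv (0, 1) v x s := fun hv => by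
    funext s; exact (hasDerivAt_time hv x s).deriv
  have hb2 := (hb.time hw).time (hw.partialDeriv _)
  have hR : 0 ≤ R 2 := (abs_nonneg _).trans (hb2.abs_le (x := x) h0 (by linarith))
  have key := abs_taylor_one_le (contDiff_time hw x) (x := t) (y := s) hR fun z hz => by
    rw [Set.uIcc_of_le hs.le] at hz
    rw [e hw, e (hw.partialDeriv _)]
    exact hb2.abs_le (by linarith [hz.1]) (by linarith [hz.2])
  rw [e hw] at key
  have e2 : (w x (t + s) - w x t) / s - _root_.partialDeriv (0, 1) w x t
      = (w x (t + s) - w x t - s * _root_.partialDeriv (0, 1) w x t) / s := by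
    field_simp
  rw [e2, abs_div, abs_of_pos hs, div_le_iff₀ hs]
  rw [abs_of_pos hs] at key
  linarith

/-- Allows identities known only for `0 ≤ t ≤ T` to be differentiated in time, endpoints included,
where just a one-sided derivative is seen. -/
theorem hasDerivAt_eq_zero_of_eqOn_Icc {F : ℝ → ℝ} {F' t : ℝ} (hT : 0 < T)
    (hF : HasDerivAt F F' t) (h : ∀ s ∈ Set.Icc 0 T, F s = 0) (ht : t ∈ Set.Icc 0 T) :
    F' = 0 :=
  (uniqueDiffOn_Icc hT t ht).eq_deriv _ hF.hasDerivWithinAt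
    ((hasDerivWithinAt_const t _ (0 : ℝ)).congr h (h t ht))

end Partial

/-! ### Increment of the projective step, and the two sources of well-prepared data -/

section Core

variable {J : ℕ} {m : KineticModel J} {P : Type*} {ε h t : P → ℝ} {u : P → ℝ → ℝ}

/-- Distance between the increment of the projective step and the rate of change of the limiting
advection-diffusion equation. -/
theorem IsWellPrepared.exists_bound_increment {f : P → Fin J ⊕ Fin 2 → ℝ → ℝ} {H κ : ℝ} (K : ℕ)
    (hε : ∀ p, 0 < ε p) (hε1 : ∀ p, ε p ≤ 1) (hh : ∀ p, 0 < h p) (hH : ∀ p, h p ^ 2 ≤ H)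
    (hκ : 0 < κ) (hu : IsSmoothO (fun _ => 1) u) (hf : IsWellPrepared m ε h u f) :
    ∃ C : ℝ, ∀ (p : P) (x₀ Δt : ℝ) (i : ℤ), 0 < Δt → κ * h p ^ 2 ≤ Δt →
      |(gridDensity (m.pfeStep K (ε p) (ε p) Δt (h p) fun l => sampleAt x₀ (h p) (f p l)) i
          - ∑ l, f p l (x₀ + i * h p)) / Δt
        + (deriv (fun y => m.A (u p y)) (x₀ + i * h p)
          - ε p * m.diffSpeed (ε p) ^ 2 / m.theta ^ 2 *
            iteratedDeriv 2 (fun y => m.B (u p y)) (x₀ + i * h p))|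
        ≤ C * (ε p + Δt + ε p ^ 2 / Δt) := by
  choose C hC using fun k => ((hf.innerStepFn_iterate hε hε1 hh hH hu k).isSmoothO_rate hε hε1 hh
    hu).bound
  refine ⟨(|C K| + ∑ k ∈ Finset.range (K + 1), (|C k| + |C K|)) * (1 + 1 / κ),
    fun p x₀ Δt i hΔt hκΔ => ?_⟩
  set x := x₀ + i * h p
  set Q := deriv (fun y => m.A (u p y)) x - ε p * m.diffSpeed (ε p) ^ 2 / m.theta ^ 2 *
            iteratedDeriv 2 (fun y => m.B (u p y)) x with hQ
  set S : ℕ → ℝ := fun k =>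
    ∑ l, m.convectionFn (ε p) (h p) ((m.innerStepFn (ε p) (h p))^[k] (f p)) l x with hS
  have hCk : ∀ k, |S k - Q| ≤ |C k| * (ε p + h p ^ 2) := fun k =>
    (hC k p x).trans (mul_le_mul_of_nonneg_right (le_abs_self _)
      (add_nonneg (hε p).le (sq_nonneg _)))
  have hεp := hε p
  rw [m.gridDensity_pfeStep_sampleAt hεp]
  change |(∑ l, f p l x - ε p * ∑ k ∈ Finset.range (K + 1), S k - (Δt - (K + 1) * ε p) * S K
    - ∑ l, f p l x) / Δt + Q| ≤ _
  -- Since the weights of the rates `S k` add up to `Δt`, the common value `Q` can be subtracted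
  -- from each of them.
  have e : (∑ l, f p l x - ε p * ∑ k ∈ Finset.range (K + 1), S k - (Δt - (K + 1) * ε p) * S K
      - ∑ l, f p l x) / Δt + Q
      = -((S K - Q) + ε p / Δt * ∑ k ∈ Finset.range (K + 1), ((S k - Q) - (S K - Q))) := by
    simp only [sub_sub_sub_cancel_right, Finset.sum_sub_distrib, Finset.sum_const,
      Finset.card_range, nsmul_eq_mul]
    push_cast
    field_simp
    ring
  have hr : 0 ≤ ε p / Δt := by positivity
  have hw : 0 ≤ ε p + h p ^ 2 := by positivity
  have hsum : |∑ k ∈ Finset.range (K + 1), ((S k - Q) - (S K - Q))|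
      ≤ (∑ k ∈ Finset.range (K + 1), (|C k| + |C K|)) * (ε p + h p ^ 2) := by
    rw [Finset.sum_mul]
    refine (Finset.abs_sum_le_sum_abs _ _).trans (Finset.sum_le_sum fun k _ => ?_)
    rw [add_mul]
    exact (abs_sub _ _).trans (add_le_add (hCk k) (hCk K))
  set D := ∑ k ∈ Finset.range (K + 1), (|C k| + |C K|)
  have hD : 0 ≤ D := Finset.sum_nonneg fun k _ => by positivity
  have hh2 : h p ^ 2 ≤ Δt / κ := by rw [le_div_iff₀ hκ]; linarith
  rw [e, abs_neg]
  calc |(S K - Q) + ε p / Δt * ∑ k ∈ Finset.range (K + 1), ((S k - Q) - (S K - Q))|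
      ≤ |S K - Q| + ε p / Δt * |∑ k ∈ Finset.range (K + 1), ((S k - Q) - (S K - Q))| := by
        refine (abs_add_le _ _).trans ?_
        rw [abs_mul, abs_of_nonneg hr]
    _ ≤ |C K| * (ε p + h p ^ 2) + ε p / Δt * (D * (ε p + h p ^ 2)) :=
        add_le_add (hCk K) (mul_le_mul_of_nonneg_left hsum hr)
    _ ≤ (|C K| + D) * ((1 + ε p / Δt) * (ε p + h p ^ 2)) := by
        have h1 : 0 ≤ |C K| * (ε p / Δt * (ε p + h p ^ 2)) := by positivity
        have h2 : 0 ≤ D * (ε p + h p ^ 2) := by positivity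
        linarith
    _ ≤ (|C K| + D) * ((1 + 1 / κ) * (ε p + Δt + ε p ^ 2 / Δt)) := by
        refine mul_le_mul_of_nonneg_left ?_ (by positivity)
        -- With `h² ≤ Δt/κ`, the cross term `(ε/Δt)(Δt/κ)` is just `ε/κ`. The nonnegative terms
        -- added below complete the product with `1 + 1/κ`.
        calc (1 + ε p / Δt) * (ε p + h p ^ 2) ≤ (1 + ε p / Δt) * (ε p + Δt / κ) := by gcongr
          _ = ε p + Δt / κ + ε p ^ 2 / Δt + ε p / κ := by field_simp; ring
          _ ≤ ε p + Δt / κ + ε p ^ 2 / Δt + ε p / κ + (Δt + ε p ^ 2 / Δt / κ) :=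
              le_add_of_nonneg_right (by positivity)
          _ = _ := by ring
    _ = _ := by ring

/-- The continuous convective rate of change of a well-prepared state. -/
theorem IsWellPrepared.isSmoothO_continuous_rate {f : P → Fin J ⊕ Fin 2 → ℝ → ℝ}
    (hε : ∀ p, 0 < ε p) (hu : IsSmoothO (fun _ => 1) u) (hf' : ∀ p l, ContDiff ℝ ∞ (f p l))
    (hf : IsWellPrepared m ε h u f) :
    IsSmoothO (fun p => ε p + h p ^ 2) fun p x => ∑ l, m.velocity (ε p) l * deriv (f p l) x
      - (deriv (fun y => m.A (u p y)) x - ε p * m.diffSpeed (ε p) ^ 2 / m.theta ^ 2 *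
          iteratedDeriv 2 (fun y => m.B (u p y)) x) := by
  refine ((IsSmoothO.sum Finset.univ fun l _ =>
    ((hf.transport l).deriv.of_eps_to_sum (h := h) hε).const_mul (m.lam l)).add
      hf.diffusive_flux.deriv).congr fun p x => ?_
  have hB : ContDiff ℝ ∞ fun y => m.B (u p y) := m.smooth_B.comp (hu.1 p)
  have d : ∀ l, HasDerivAt (f p l) (deriv (f p l) x) x := fun l =>
    ((hf' p l).differentiable_infty x).hasDerivAt
  have e1 : ∀ l, deriv (fun x => f p (Sum.inl l) x - m.maxw l (u p x)) x
      = deriv (f p (Sum.inl l)) x - deriv (fun x => m.maxw l (u p x)) x := fun l =>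
    deriv_fun_sub (d _).differentiableAt
      (((m.smooth_maxw l).comp (hu.1 p)).differentiable_infty x)
  have e2 := ((((d (Sum.inr 1)).sub (d (Sum.inr 0))).const_mul (m.diffSpeed (ε p))).add
    (((hB.deriv_infty.differentiable_infty x).hasDerivAt).const_mul
      (ε p * m.diffSpeed (ε p) ^ 2 / m.theta ^ 2))).deriv
  rw [m.deriv_A_comp (hu.1 p)]
  erw [e2]
  simp only [e1, mul_sub, Finset.sum_sub_distrib, Fintype.sum_sum_type, Fin.sum_univ_two,
    m.velocity_inr_zero, m.velocity_inr_one, iteratedDeriv_succ, iteratedDeriv_zero]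
  simp only [KineticModel.velocity, Sum.elim_inl]
  ring

theorem KineticModel.IsKineticSolution.eq_maxwellian_sub {f : Fin J ⊕ Fin 2 → ℝ → ℝ → ℝ}
    {ε T : ℝ} (hf : m.IsKineticSolution ε T f) (hε : 0 < ε) {t : ℝ} (h0 : 0 ≤ t) (h1 : t ≤ T)
    (l : Fin J ⊕ Fin 2) (x : ℝ) :
    f l x t = m.maxwellian l (∑ k, f k x t) - ε * partialDeriv (0, 1) (f l) x t
      - ε * m.velocity ε l * partialDeriv (1, 0) (f l) x t := by
  have := hf.2 l x t h0 h1
  rw [(hasDerivAt_time (hf.1 l) x t).deriv, (hasDerivAt_space (hf.1 l) x t).deriv] at this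
  field_simp at this
  linarith

theorem KineticModel.IsKineticSolution.sum_time_deriv {f : Fin J ⊕ Fin 2 → ℝ → ℝ → ℝ}
    {ε T : ℝ} (hf : m.IsKineticSolution ε T f) {t : ℝ} (h0 : 0 ≤ t) (h1 : t ≤ T) (x : ℝ) :
    ∑ l, partialDeriv (0, 1) (f l) x t
      = -∑ l, m.velocity ε l * deriv (fun y => f l y t) x := by
  rw [← sub_eq_zero, sub_neg_eq_add, ← Finset.sum_add_distrib]
  have : ∀ l, partialDeriv (0, 1) (f l) x t + m.velocity ε l * deriv (fun y => f l y t) x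
      = (1 / ε) * (m.maxwellian l (∑ k, f k x t) - f l x t) := fun l => by
    rw [← hf.2 l x t h0 h1, (hasDerivAt_time (hf.1 l) x t).deriv]
  simp only [this, ← Finset.mul_sum, Finset.sum_sub_distrib, m.sum_maxwellian, sub_self, mul_zero]

/-- The time derivative of the difference of the diffusive components. -/
theorem KineticModel.IsKineticSolution.time_deriv_sub {f : Fin J ⊕ Fin 2 → ℝ → ℝ → ℝ}
    {ε T : ℝ} (hf : m.IsKineticSolution ε T f) (hε : 0 < ε) (hT : 0 < T) {t : ℝ} (h0 : 0 ≤ t)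
    (h1 : t ≤ T) (x : ℝ) :
    partialDeriv (0, 1) (f (Sum.inr 1)) x t - partialDeriv (0, 1) (f (Sum.inr 0)) x t
      = -(ε * (partialDeriv (0, 1) (partialDeriv (0, 1) (f (Sum.inr 1))) x t
          - partialDeriv (0, 1) (partialDeriv (0, 1) (f (Sum.inr 0))) x t))
        - ε * m.diffSpeed ε * (partialDeriv (0, 1) (partialDeriv (1, 0) (f (Sum.inr 1))) x t
          + partialDeriv (0, 1) (partialDeriv (1, 0) (f (Sum.inr 0))) x t) := by
  have dt : ∀ k s, HasDerivAt (fun s => f (Sum.inr k) x s) _ s := fun k s =>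
    hasDerivAt_time (hf.1 _) x s
  have dtt : ∀ k s, HasDerivAt (fun s => partialDeriv (0, 1) (f (Sum.inr k)) x s) _ s := fun k s =>
    hasDerivAt_time ((hf.1 _).partialDeriv _) x s
  have dxt : ∀ k s, HasDerivAt (fun s => partialDeriv (1, 0) (f (Sum.inr k)) x s) _ s := fun k s =>
    hasDerivAt_time ((hf.1 _).partialDeriv _) x s
  -- The Maxwellians cancel in the difference of the two equations, leaving `d + ε ∂ₜd + ε c ∂ₓs =
  -- 0` on `[0, T]`; this relation is differentiated in time.
  have key := hasDerivAt_eq_zero_of_eqOn_Icc hT ((((dt 1 t).sub (dt 0 t)).add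
    (((dtt 1 t).sub (dtt 0 t)).const_mul ε)).add
      (((dxt 1 t).add (dxt 0 t)).const_mul (ε * m.diffSpeed ε))) (fun s hs => by
        have a1 := hf.eq_maxwellian_sub hε hs.1 hs.2 (Sum.inr 1) x
        have a0 := hf.eq_maxwellian_sub hε hs.1 hs.2 (Sum.inr 0) x
        simp only [m.velocity_inr_zero, m.velocity_inr_one, KineticModel.maxwellian,
          Sum.elim_inr] at a0 a1
        simp only [Pi.add_apply, Pi.sub_apply]
        linarith) ⟨h0, h1⟩
  linarith

/-- Kinetic solutions with bounded derivatives are well prepared. -/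
theorem KineticModel.IsKineticSolution.isWellPrepared {f : P → Fin J ⊕ Fin 2 → ℝ → ℝ → ℝ}
    {T : ℝ} {R : ℕ → ℝ} (hT : 0 < T) (hε : ∀ p, 0 < ε p) (hε1 : ∀ p, ε p ≤ 1)
    (hf : ∀ p, m.IsKineticSolution (ε p) T (f p)) (hb : ∀ p l, HasDerivBounds T R (f p l))
    (h0 : ∀ p, 0 ≤ t p) (h1 : ∀ p, t p ≤ T) :
    IsWellPrepared m ε h (fun p x => ∑ l, f p l x (t p)) (fun p l x => f p l x (t p)) := by
  have sf : ∀ l, IsSmoothO (fun _ => 1) fun p x => f p l x (t p) := fun l =>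
    isSmoothO_of_hasDerivBounds (fun p => (hf p).1 l) (fun p => hb p l) h0 h1
  have sx : ∀ l, IsSmoothO (fun _ => 1) fun p x => partialDeriv (1, 0) (f p l) x (t p) := fun l =>
    isSmoothO_of_hasDerivBounds (fun p => ((hf p).1 l).partialDeriv _)
      (fun p => (hb p l).space ((hf p).1 l)) h0 h1
  have st : ∀ l, IsSmoothO (fun _ => 1) fun p x => partialDeriv (0, 1) (f p l) x (t p) := fun l =>
    isSmoothO_of_hasDerivBounds (fun p => ((hf p).1 l).partialDeriv _)
      (fun p => (hb p l).time ((hf p).1 l)) h0 h1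
  have stt : ∀ l, IsSmoothO (fun _ => 1) fun p x =>
      partialDeriv (0, 1) (partialDeriv (0, 1) (f p l)) x (t p) := fun l =>
    isSmoothO_of_hasDerivBounds (fun p => (((hf p).1 l).partialDeriv _).partialDeriv _)
      (fun p => ((hb p l).time ((hf p).1 l)).time (((hf p).1 l).partialDeriv _)) h0 h1
  have sxt : ∀ l, IsSmoothO (fun _ => 1) fun p x =>
      partialDeriv (0, 1) (partialDeriv (1, 0) (f p l)) x (t p) := fun l =>
    isSmoothO_of_hasDerivBounds (fun p => (((hf p).1 l).partialDeriv _).partialDeriv _)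
      (fun p => ((hb p l).space ((hf p).1 l)).time (((hf p).1 l).partialDeriv _)) h0 h1
  have eqf : ∀ p l x, _ := fun p l x =>
    (hf p).eq_maxwellian_sub (hε p) (h0 p) (h1 p) l x
  have eqx : ∀ p l x, deriv (fun y => f p l y (t p)) x = partialDeriv (1, 0) (f p l) x (t p) :=
    fun p l x => (hasDerivAt_space ((hf p).1 l) x (t p)).deriv
  have hθ := m.theta_pos.ne'
  have hμθ : 0 ≤ m.mu + m.theta := add_nonneg m.mu_nonneg m.theta_pos.le
  have hsq : ∀ p, ε p * m.diffSpeed (ε p) ≤ (m.mu + m.theta) * √(ε p) := fun p => by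
    calc ε p * m.diffSpeed (ε p) = m.diffSpeed (ε p) * √(ε p) * √(ε p) := by
          rw [mul_assoc, Real.mul_self_sqrt (hε p).le, mul_comm]
      _ ≤ _ := mul_le_mul_of_nonneg_right (m.diffSpeed_mul_sqrt_le (hε p) (hε1 p))
          (Real.sqrt_nonneg _)
  have hsn : ∀ p, 0 ≤ ε p * m.diffSpeed (ε p) := fun p =>
    mul_nonneg (hε p).le (m.diffSpeed_nonneg _)
  -- A first factor `ε c` gains `√ε` over the a priori bounds; this applies to `d` and to `∂ₜd`.
  have small : ∀ {g g' : P → ℝ → ℝ}, IsSmoothO (fun _ => 1) g → IsSmoothO (fun _ => 1) g' →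
      IsSmoothO (fun p => √(ε p)) fun p x =>
        -(ε p * g p x) - ε p * m.diffSpeed (ε p) * g' p x := by
    intro g g' hg hg'
    refine (IsSmoothO.neg ?_).sub ?_
    · refine hg.const_mul_of_le ε 1 fun p => ?_
      rw [abs_of_pos (hε p), abs_one, mul_one, one_mul]
      exact Real.le_sqrt_of_sq_le (by nlinarith [hε p, hε1 p])
    · refine hg'.const_mul_of_le _ (m.mu + m.theta) fun p => ?_
      rw [abs_of_nonneg (hsn p), abs_one, mul_one]
      exact hsq p
  -- A second factor `ε c` raises `√ε` to `ε`.
  have up : ∀ {g : P → ℝ → ℝ}, IsSmoothO (fun p => √(ε p)) g →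
      IsSmoothO ε fun p x => ε p * m.diffSpeed (ε p) * g p x := by
    intro g hg
    refine hg.const_mul_of_le _ (m.mu + m.theta) fun p => ?_
    rw [abs_of_nonneg (hsn p), abs_of_nonneg (Real.sqrt_nonneg _)]
    calc _ ≤ (m.mu + m.theta) * √(ε p) * √(ε p) :=
          mul_le_mul_of_nonneg_right (hsq p) (Real.sqrt_nonneg _)
      _ = _ := by rw [mul_assoc, Real.mul_self_sqrt (hε p).le]
  have hd : IsSmoothO (fun p => √(ε p)) fun p x =>
      f p (Sum.inr 1) x (t p) - f p (Sum.inr 0) x (t p) := by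
    refine (small ((st (Sum.inr 1)).sub (st (Sum.inr 0)))
      ((sx (Sum.inr 1)).add (sx (Sum.inr 0)))).congr fun p x => ?_
    rw [eqf p (Sum.inr 1), eqf p (Sum.inr 0)]
    simp only [KineticModel.maxwellian, Sum.elim_inr, m.velocity_inr_zero, m.velocity_inr_one]
    ring
  have hdx : IsSmoothO (fun p => √(ε p)) fun p x =>
      partialDeriv (1, 0) (f p (Sum.inr 1)) x (t p)
        - partialDeriv (1, 0) (f p (Sum.inr 0)) x (t p) := by
    refine hd.deriv.congr fun p x => ?_
    rw [← eqx, ← eqx]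
    exact (deriv_fun_sub (((sf (Sum.inr 1)).1 p).differentiable_infty x)
      (((sf (Sum.inr 0)).1 p).differentiable_infty x)).symm
  have hdt : IsSmoothO (fun p => √(ε p)) fun p x =>
      partialDeriv (0, 1) (f p (Sum.inr 1)) x (t p)
        - partialDeriv (0, 1) (f p (Sum.inr 0)) x (t p) := by
    refine (small ((stt (Sum.inr 1)).sub (stt (Sum.inr 0)))
      ((sxt (Sum.inr 1)).add (sxt (Sum.inr 0)))).congr fun p x => ?_
    rw [(hf p).time_deriv_sub (hε p) hT (h0 p) (h1 p)]
  -- The sum of the two equations is `s = B(u)/θ² - ε ∂ₜs - ε c ∂ₓd`, with `∂ₓd = O(√ε)`.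
  have hs : IsSmoothO ε fun p x => f p (Sum.inr 0) x (t p) + f p (Sum.inr 1) x (t p)
      - m.B (∑ l, f p l x (t p)) / m.theta ^ 2 := by
    refine ((((st (Sum.inr 0)).add (st (Sum.inr 1))).eps_mul hε).neg.sub (up hdx)).congr
      fun p x => ?_
    have a0 := eqf p (Sum.inr 0) x
    have a1 := eqf p (Sum.inr 1) x
    simp only [KineticModel.maxwellian, Sum.elim_inr, m.velocity_inr_zero,
      m.velocity_inr_one] at a0 a1
    have e : m.B (∑ l, f p l x (t p)) / m.theta ^ 2
        = 2 * (m.B (∑ l, f p l x (t p)) / (2 * m.theta ^ 2)) := by field_simp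
    rw [e]
    linarith
  have hu : IsSmoothO (fun _ => 1) fun p x => ∑ l, f p l x (t p) :=
    IsSmoothO.sum Finset.univ fun l _ => sf l
  refine ⟨IsSmoothO.zero.congr fun p x => sub_self _, fun l => ?_, hs, ?_⟩
  · refine (((st (Sum.inl l)).add ((sx (Sum.inl l)).const_mul (m.lam l))).eps_mul hε).neg.congr
      fun p x => ?_
    have a := eqf p (Sum.inl l) x
    simp only [KineticModel.maxwellian, KineticModel.velocity, Sum.elim_inl] at a
    linarith
  -- Here `c d = -ε c ∂ₜd - ε c² ∂ₓs`: the first term is `O(ε)` because `∂ₜd = O(√ε)`, and `∂ₓs` is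
  -- known up to `O(ε)` from `hs`.
  · have h2 := (hs.deriv.const_mul (m.theta ^ 2)).diffusionFlux (m := m) hε hε1
    refine (((up hdt).neg.sub h2).of_eps_to_sum hε).congr fun p x => ?_
    have hBs : ContDiff ℝ ∞ fun y => m.B (∑ l, f p l y (t p)) := m.smooth_B.comp (hu.1 p)
    have e : deriv (fun x => f p (Sum.inr 0) x (t p) + f p (Sum.inr 1) x (t p)
        - m.B (∑ l, f p l x (t p)) / m.theta ^ 2) x
        = partialDeriv (1, 0) (f p (Sum.inr 0)) x (t p)
          + partialDeriv (1, 0) (f p (Sum.inr 1)) x (t p)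
          - deriv (fun y => m.B (∑ l, f p l y (t p))) x / m.theta ^ 2 :=
      (((hasDerivAt_space ((hf p).1 _) x (t p)).add
        (hasDerivAt_space ((hf p).1 _) x (t p))).sub
          ((hBs.differentiable_infty x).hasDerivAt.div_const _)).deriv
    have a0 := eqf p (Sum.inr 0) x
    have a1 := eqf p (Sum.inr 1) x
    simp only [KineticModel.maxwellian, Sum.elim_inr, m.velocity_inr_zero,
      m.velocity_inr_one] at a0 a1
    have a : f p (Sum.inr 1) x (t p) - f p (Sum.inr 0) x (t p)
        = -(ε p * (partialDeriv (0, 1) (f p (Sum.inr 1)) x (t p)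
            - partialDeriv (0, 1) (f p (Sum.inr 0)) x (t p)))
          - ε p * m.diffSpeed (ε p) * (partialDeriv (1, 0) (f p (Sum.inr 1)) x (t p)
            + partialDeriv (1, 0) (f p (Sum.inr 0)) x (t p)) := by
      linarith
    rw [e, a]
    field_simp
    ring

/-- States that follow the Chapman-Enskog expansion are well prepared. -/
theorem isWellPrepared_of_chapmanEnskog {φ : P → Fin J ⊕ Fin 2 → ℝ → ℝ} {R : ℕ → ℝ}
    (hε : ∀ p, 0 < ε p) (hu : IsSmoothO (fun _ => 1) u)
    (hφ : ∀ p, m.IsChapmanEnskogState (ε p) R (u p) (φ p)) : IsWellPrepared m ε h u φ := by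
  have hM : ∀ l p, ContDiff ℝ ∞ fun x => m.maxwellian l (u p x) := by
    rintro (l | k) p
    · exact (m.smooth_maxw l).comp (hu.1 p)
    · exact (m.smooth_B.comp (hu.1 p)).div_const _
  have hρs : ∀ l p, ContDiff ℝ ∞ (m.expansionRemainder (ε p) (u p) (φ p) l) := fun l p =>
    ((hφ p).1 l).sub ((hM l p).sub (contDiff_const.mul (hM l p).deriv_infty))
  have hρ : ∀ l, IsSmoothO ε fun p => m.expansionRemainder (ε p) (u p) (φ p) l := fun l =>
    ⟨hρs l, fun n => ⟨R n, fun p x => (hφ p).2.2.1 l n x⟩⟩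
  have hγρ : IsSmoothO ε fun p x =>
      ∑ l, m.velocity (ε p) l * m.expansionRemainder (ε p) (u p) (φ p) l x :=
    ⟨fun p => ContDiff.sum fun l _ => contDiff_const.mul (hρs l p),
      fun n => ⟨R n, fun p x => (hφ p).2.2.2 n x⟩⟩
  have hφe : ∀ p l x, φ p l x = m.expansionRemainder (ε p) (u p) (φ p) l x
      + m.maxwellian l (u p x)
      - ε p * m.velocity (ε p) l * deriv (fun y => m.maxwellian l (u p y)) x := fun p l x => by
    simp only [KineticModel.expansionRemainder]; ring
  have hθ := m.theta_pos.ne'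
  refine ⟨IsSmoothO.zero.congr fun p x => ?_, fun l => ?_, ?_, ?_⟩
  · rw [(hφ p).2.1, sub_self]
  · refine ((hρ (Sum.inl l)).sub (((hu.transport (m := m) l).deriv.const_mul
      (m.lam l)).eps_mul hε)).congr fun p x => ?_
    rw [hφe]
    simp only [KineticModel.maxwellian, KineticModel.velocity, Sum.elim_inl]
    ring
  -- The first-order corrections of the two components are opposite, so only the remainders are left
  -- in the sum.
  · refine ((hρ (Sum.inr 0)).add (hρ (Sum.inr 1))).congr fun p x => ?_
    rw [hφe p (Sum.inr 0), hφe p (Sum.inr 1)]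
    simp only [KineticModel.maxwellian, Sum.elim_inr, m.velocity_inr_zero, m.velocity_inr_one]
    field_simp
    ring
  -- Bounds on each remainder alone would lose a factor `c`. The bound on `∑ γ_l ρ_l`, minus its
  -- transport part, controls `c` times the difference of the two diffusive remainders; the
  -- first-order corrections give exactly `-(ε c²/θ²) ∂ₓB(u)`.
  · refine ((hγρ.sub (IsSmoothO.sum Finset.univ fun l _ =>
      (hρ (Sum.inl l)).const_mul (m.lam l))).of_eps_to_sum hε).congr fun p x => ?_
    rw [hφe p (Sum.inr 0), hφe p (Sum.inr 1)]
    simp only [KineticModel.maxwellian, Sum.elim_inr, m.velocity_inr_zero, m.velocity_inr_one,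
      Fintype.sum_sum_type, Fin.sum_univ_two, deriv_div_const]
    simp only [KineticModel.velocity, Sum.elim_inl]
    field_simp
    ring

end Core

end

/-! ### Truncation error bounds -/

noncomputable section

variable {J : ℕ}

/-- A time level of a kinetic solution with bounded derivatives, with a bounded mesh size. -/
structure KineticSample (m : KineticModel J) (T H : ℝ) (R : ℕ → ℝ) where
  ε : ℝ
  h : ℝ
  t : ℝ
  f : Fin J ⊕ Fin 2 → ℝ → ℝ → ℝ
  ε_pos : 0 < ε
  ε_le : ε ≤ 1
  h_pos : 0 < h
  h_sq_le : h ^ 2 ≤ H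
  t_nonneg : 0 ≤ t
  t_le : t ≤ T
  isKineticSolution : m.IsKineticSolution ε T f
  hasDerivBounds : ∀ l, HasDerivBounds T R (f l)

/-- A time level of a parabolic solution with bounded derivatives, a Chapman-Enskog state of the
same density, and a bounded mesh size. -/
structure ChapmanEnskogSample (m : KineticModel J) (T H : ℝ) (R : ℕ → ℝ) where
  ε : ℝ
  h : ℝ
  t : ℝ
  u : ℝ → ℝ → ℝ
  φ : Fin J ⊕ Fin 2 → ℝ → ℝ
  ε_pos : 0 < ε
  ε_le : ε ≤ 1
  h_pos : 0 < h
  h_sq_le : h ^ 2 ≤ H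
  t_nonneg : 0 ≤ t
  t_le : t ≤ T
  isParabolicSolution : m.IsParabolicSolution T u
  hasDerivBounds : HasDerivBounds T R u
  isChapmanEnskogState : m.IsChapmanEnskogState ε R (fun x => u x t) φ

/-- A time level of a parabolic solution with bounded derivatives and a mesh size. -/
structure ParabolicSample (m : KineticModel J) (T : ℝ) (R : ℕ → ℝ) where
  h : ℝ
  t : ℝ
  u : ℝ → ℝ → ℝ
  h_pos : 0 < h
  t_nonneg : 0 ≤ t
  t_le : t ≤ T
  isParabolicSolution : m.IsParabolicSolution T u
  hasDerivBounds : HasDerivBounds T R u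

namespace KineticModel

variable (m : KineticModel J)

theorem IsParabolicSolution.time_deriv {m : KineticModel J} {T : ℝ} {u : ℝ → ℝ → ℝ}
    (hu : m.IsParabolicSolution T u) {t : ℝ} (h0 : 0 ≤ t) (h1 : t ≤ T) (x : ℝ) :
    partialDeriv (0, 1) u x t = iteratedDeriv 2 (fun y => m.B (u y t)) x
      - deriv (fun y => m.A (u y t)) x := by
  rw [← hu.2 x t h0 h1, (hasDerivAt_time hu.1 x t).deriv]; ring

/-- With `s = (μ/√2) √ε` one has `ε c² = (s + θ)²`, so the defect is `-(s + 2θ) s/θ²`, which is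
linear in `s` up to a bounded factor and vanishes for `μ = 0`. -/
theorem abs_diffusion_defect_le {ε : ℝ} (hε : 0 < ε) (hε1 : ε ≤ 1) :
    |1 - ε * m.diffSpeed ε ^ 2 / m.theta ^ 2|
      ≤ (m.mu + 2 * m.theta) / m.theta ^ 2 * (m.mu * √ε) := by
  have hθ := m.theta_pos
  have hμ := m.mu_nonneg
  set s := m.mu / √2 * √ε with hs
  have hs0 : 0 ≤ s := by positivity
  have hs1 : s ≤ m.mu * √ε := mul_le_mul_of_nonneg_right
    (div_le_self hμ (Real.one_le_sqrt.2 one_le_two)) (Real.sqrt_nonneg _)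
  have hs2 : s ≤ m.mu := hs1.trans (mul_le_of_le_one_right hμ (Real.sqrt_le_one.2 hε1))
  have e : ε * m.diffSpeed ε ^ 2 = (s + m.theta) ^ 2 := by
    rw [hs, ← m.diffSpeed_mul_sqrt hε, mul_pow, Real.sq_sqrt hε.le]; ring
  have e2 : 1 - ε * m.diffSpeed ε ^ 2 / m.theta ^ 2 = -((s + 2 * m.theta) * s / m.theta ^ 2) := by
    rw [e]; field_simp; ring
  rw [e2, abs_neg, abs_of_nonneg (by positivity), div_mul_eq_mul_div]
  gcongr

/-- The exact density and the scheme are compared with the same rate `Q`, which keeps the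
coefficient `ε c²/θ²`. Hence no `μ√ε` term appears. -/
theorem exists_bound_truncationError_kinetic (K : ℕ) {T : ℝ} (hT : 0 < T) (R : ℕ → ℝ) {κ : ℝ}
    (hκ : 0 < κ) (H : ℝ) :
    ∃ C : ℝ, ∀ (p : KineticSample m T H R) (x₀ Δt : ℝ) (i : ℤ), 0 < Δt → κ * p.h ^ 2 ≤ Δt →
      p.t + Δt ≤ T →
      |truncationError x₀ p.h Δt (fun x t => ∑ l, p.f l x t) (p.t + Δt)
          (gridDensity (m.pfeStep K p.ε p.ε Δt p.h
            (fun l => sampleAt x₀ p.h (fun x => p.f l x p.t)))) i|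
        ≤ C * (p.ε + Δt + p.ε ^ 2 / Δt) := by
  have hε := fun p : KineticSample m T H R => p.ε_pos
  have hwp := KineticModel.IsKineticSolution.isWellPrepared (h := fun p : KineticSample m T H R =>
    p.h) hT hε (fun p => p.ε_le) (fun p => p.isKineticSolution) (fun p => p.hasDerivBounds)
    (fun p => p.t_nonneg) (fun p => p.t_le)
  have hu : IsSmoothO (fun _ => 1) fun (p : KineticSample m T H R) x => ∑ l, p.f l x p.t :=
    IsSmoothO.sum Finset.univ fun l _ => isSmoothO_of_hasDerivBounds
      (fun p => p.isKineticSolution.1 l) (fun p => p.hasDerivBounds l) (fun p => p.t_nonneg)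
      (fun p => p.t_le)
  obtain ⟨C₁, hC₁⟩ := hwp.exists_bound_increment K hε (fun p => p.ε_le) (fun p => p.h_pos)
    (fun p => p.h_sq_le) hκ hu
  obtain ⟨C₂, hC₂⟩ := (hwp.isSmoothO_continuous_rate hε hu
    (fun p l => contDiff_space (p.isKineticSolution.1 l) p.t)).bound
  refine ⟨Fintype.card (Fin J ⊕ Fin 2) * |R 2| + |C₂| * (1 + 1 / κ) + C₁,
    fun p x₀ Δt i hΔt hκΔ hΔT => ?_⟩
  have b1 := hC₁ p x₀ Δt i hΔt hκΔ
  have b2 := hC₂ p (x₀ + i * p.h)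
  set x := x₀ + i * p.h
  set Q := deriv (fun y => m.A (∑ l, p.f l y p.t)) x - p.ε * m.diffSpeed p.ε ^ 2 / m.theta ^ 2 *
            iteratedDeriv 2 (fun y => m.B (∑ l, p.f l y p.t)) x with hQ
  set G := gridDensity (m.pfeStep K p.ε p.ε Δt p.h
            (fun l => sampleAt x₀ p.h (fun x => p.f l x p.t))) i with hG
  have hrate := p.isKineticSolution.sum_time_deriv p.t_nonneg p.t_le x
  have e : truncationError x₀ p.h Δt (fun x t => ∑ l, p.f l x t) (p.t + Δt)
          (gridDensity (m.pfeStep K p.ε p.ε Δt p.h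
            (fun l => sampleAt x₀ p.h (fun x => p.f l x p.t)))) i
      = ∑ l, ((p.f l x (p.t + Δt) - p.f l x p.t) / Δt - partialDeriv (0, 1) (p.f l) x p.t)
        - (∑ l, m.velocity p.ε l * deriv (fun y => p.f l y p.t) x - Q)
        - ((G - ∑ l, p.f l x p.t) / Δt + Q) := by
    rw [Finset.sum_sub_distrib, hrate, ← Finset.sum_div, Finset.sum_sub_distrib]
    simp only [truncationError, sampleAt]
    ring
  have b3 : |∑ l, ((p.f l x (p.t + Δt) - p.f l x p.t) / Δt
      - partialDeriv (0, 1) (p.f l) x p.t)| ≤ Fintype.card (Fin J ⊕ Fin 2) * |R 2| * Δt := by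
    refine (Finset.abs_sum_le_sum_abs _ _).trans ?_
    refine (Finset.sum_le_card_nsmul _ _ (|R 2| * Δt) fun l _ => ?_).trans (by
      rw [nsmul_eq_mul, Finset.card_univ, mul_assoc])
    exact ((p.hasDerivBounds l).abs_time_taylor_le (p.isKineticSolution.1 l) p.t_nonneg hΔt hΔT
      x).trans (mul_le_mul_of_nonneg_right (le_abs_self _) hΔt.le)
  have hεp := p.ε_pos
  have hh2 : p.h ^ 2 ≤ Δt / κ := by rw [le_div_iff₀ hκ]; linarith
  have hq : 0 ≤ p.ε ^ 2 / Δt := by positivity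
  have b2' : |∑ l, m.velocity p.ε l * deriv (fun y => p.f l y p.t) x - Q|
      ≤ |C₂| * ((1 + 1 / κ) * (p.ε + Δt + p.ε ^ 2 / Δt)) := by
    refine b2.trans ((mul_le_mul_of_nonneg_right (le_abs_self _)
      (add_nonneg hεp.le (sq_nonneg _))).trans (mul_le_mul_of_nonneg_left ?_ (abs_nonneg _)))
    have h1 : 0 ≤ 1 / κ * (p.ε + p.ε ^ 2 / Δt) := by positivity
    calc p.ε + p.h ^ 2 ≤ p.ε + Δt / κ := by linarith
      _ ≤ _ := by rw [div_eq_mul_one_div Δt κ]; linarith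
  have b3' : (Fintype.card (Fin J ⊕ Fin 2) * |R 2| * Δt : ℝ)
      ≤ Fintype.card (Fin J ⊕ Fin 2) * |R 2| * (p.ε + Δt + p.ε ^ 2 / Δt) :=
    mul_le_mul_of_nonneg_left (by linarith) (by positivity)
  rw [e]
  refine (abs_sub _ _).trans ((add_le_add ((abs_sub _ _).trans (add_le_add (b3.trans b3') b2'))
    b1).trans (le_of_eq ?_))
  ring

theorem exists_bound_truncationError_parabolic (K : ℕ) {T : ℝ} (R : ℕ → ℝ) {κ : ℝ}
    (hκ : 0 < κ) (H : ℝ) :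
    ∃ C : ℝ, ∀ (p : ChapmanEnskogSample m T H R) (x₀ Δt : ℝ) (i : ℤ), 0 < Δt →
      κ * p.h ^ 2 ≤ Δt → p.t + Δt ≤ T →
      |truncationError x₀ p.h Δt p.u (p.t + Δt)
          (gridDensity (m.pfeStep K p.ε p.ε Δt p.h (fun l => sampleAt x₀ p.h (p.φ l)))) i|
        ≤ C * (p.ε + m.mu * √p.ε + Δt + p.ε ^ 2 / Δt) := by
  have hε := fun p : ChapmanEnskogSample m T H R => p.ε_pos
  have hu : IsSmoothO (fun _ => 1) fun (p : ChapmanEnskogSample m T H R) x => p.u x p.t :=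
    isSmoothO_of_hasDerivBounds (fun p => p.isParabolicSolution.1) (fun p => p.hasDerivBounds)
      (fun p => p.t_nonneg) (fun p => p.t_le)
  have hwp := isWellPrepared_of_chapmanEnskog (h := fun p : ChapmanEnskogSample m T H R => p.h)
    hε hu fun p => p.isChapmanEnskogState
  obtain ⟨C₁, hC₁⟩ := hwp.exists_bound_increment K hε (fun p => p.ε_le) (fun p => p.h_pos)
    (fun p => p.h_sq_le) hκ hu
  obtain ⟨C₂, hC₂⟩ := (hu.comp m.smooth_B).2 2
  set D := (m.mu + 2 * m.theta) / m.theta ^ 2 with hD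
  have hD0 : 0 ≤ D := by
    have := m.theta_pos
    have := m.mu_nonneg
    positivity
  refine ⟨|R 2| + D * |C₂| + |C₁|, fun p x₀ Δt i hΔt hκΔ hΔT => ?_⟩
  have b1 := hC₁ p x₀ Δt i hΔt hκΔ
  have b2 := hC₂ p (x₀ + i * p.h)
  set x := x₀ + i * p.h
  have b3 := p.hasDerivBounds.abs_time_taylor_le p.isParabolicSolution.1 p.t_nonneg hΔt hΔT x
  rw [p.isParabolicSolution.time_deriv p.t_nonneg p.t_le] at b3
  rw [p.isChapmanEnskogState.2.1] at b1
  set a := deriv (fun y => m.A (p.u y p.t)) x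
  set b := iteratedDeriv 2 (fun y => m.B (p.u y p.t)) x
  set G := gridDensity (m.pfeStep K p.ε p.ε Δt p.h (fun l => sampleAt x₀ p.h (p.φ l))) i
  -- Time discretization error, defect of the diffusion coefficient, and error of the projective
  -- increment.
  have e : truncationError x₀ p.h Δt p.u (p.t + Δt)
          (gridDensity (m.pfeStep K p.ε p.ε Δt p.h (fun l => sampleAt x₀ p.h (p.φ l)))) i
      = ((p.u x (p.t + Δt) - p.u x p.t) / Δt - (b - a))
        + (1 - p.ε * m.diffSpeed p.ε ^ 2 / m.theta ^ 2) * b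
        - ((G - p.u x p.t) / Δt + (a - p.ε * m.diffSpeed p.ε ^ 2 / m.theta ^ 2 * b)) := by
    simp only [truncationError, sampleAt]
    ring
  have hεp := p.ε_pos
  have hμ := m.mu_nonneg
  have hq : 0 ≤ p.ε ^ 2 / Δt := by positivity
  have hμs : 0 ≤ m.mu * √p.ε := by positivity
  have b4 : |(1 - p.ε * m.diffSpeed p.ε ^ 2 / m.theta ^ 2) * b|
      ≤ D * |C₂| * (m.mu * √p.ε) := by
    rw [abs_mul]
    calc _ ≤ (D * (m.mu * √p.ε)) * |C₂| :=
          mul_le_mul (m.abs_diffusion_defect_le hεp p.ε_le)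
            (b2.trans (by rw [mul_one]; exact le_abs_self _)) (abs_nonneg _) (by positivity)
      _ = _ := by ring
  set W := p.ε + m.mu * √p.ε + Δt + p.ε ^ 2 / Δt
  have b1' : C₁ * (p.ε + Δt + p.ε ^ 2 / Δt) ≤ |C₁| * W :=
    (mul_le_mul_of_nonneg_right (le_abs_self _) (by positivity)).trans
      (mul_le_mul_of_nonneg_left (by simp only [W]; linarith) (abs_nonneg _))
  have b3' : R 2 * Δt ≤ |R 2| * W :=
    (mul_le_mul_of_nonneg_right (le_abs_self _) hΔt.le).trans
      (mul_le_mul_of_nonneg_left (by simp only [W]; linarith) (abs_nonneg _))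
  have b4' : D * |C₂| * (m.mu * √p.ε) ≤ D * |C₂| * W :=
    mul_le_mul_of_nonneg_left (by simp only [W]; linarith) (by positivity)
  rw [e]
  refine (abs_sub _ _).trans ((add_le_add ((abs_add_le _ _).trans (add_le_add (b3.trans b3')
    (b4.trans b4'))) (b1.trans b1')).trans (le_of_eq ?_))
  ring

theorem limitStep_sampleAt (Δt x₀ : ℝ) {h : ℝ} (u : ℝ → ℝ) (i : ℤ) :
    m.limitStep Δt h (sampleAt x₀ h u) i = u (x₀ + i * h)
      - Δt * ∑ l, m.lam l * stencil (upwindCoeff (m.lam l)) (upwindNode (m.lam l)) h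
          (fun y => m.maxw l (u y)) (x₀ + i * h)
      + Δt * stencil centeredCoeff centeredNode h
          (stencil centeredCoeff centeredNode h fun y => m.B (u y)) (x₀ + i * h) := by
  have e : ∀ l, (upwindFlux (m.lam l) (fun j => m.maxw l (sampleAt x₀ h u j)) i
        - upwindFlux (m.lam l) (fun j => m.maxw l (sampleAt x₀ h u j)) (i - 1)) / h
      = m.lam l * stencil (upwindCoeff (m.lam l)) (upwindNode (m.lam l)) h
          (fun y => m.maxw l (u y)) (x₀ + i * h) := fun l =>
    upwindFlux_sub_sampleAt (m.lam l) x₀ h (fun y => m.maxw l (u y)) i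
  have e1 : x₀ + ((i : ℝ) + 2) * h = x₀ + i * h + h + h := by ring
  have e2 : x₀ + ((i : ℝ) - 2) * h = x₀ + i * h + -h + -h := by ring
  simp only [limitStep, e]
  simp [sampleAt, stencil, centeredCoeff, centeredNode, Fin.sum_univ_three, e1, e2]
  left
  ring

theorem exists_bound_truncationError_limit {T : ℝ} (R : ℕ → ℝ) :
    ∃ C : ℝ, ∀ (p : ParabolicSample m T R) (x₀ Δt : ℝ) (i : ℤ), 0 < Δt → p.t + Δt ≤ T →
      |truncationError x₀ p.h Δt p.u (p.t + Δt)
          (m.limitStep Δt p.h (sampleAt x₀ p.h (fun x => p.u x p.t))) i|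
        ≤ C * (Δt + p.h ^ 2) := by
  have hc := isSecondOrderStencil_centered
  have hh := fun p : ParabolicSample m T R => p.h_pos
  have hu : IsSmoothO (fun _ => 1) fun (p : ParabolicSample m T R) x => p.u x p.t :=
    isSmoothO_of_hasDerivBounds (fun p => p.isParabolicSolution.1) (fun p => p.hasDerivBounds)
      (fun p => p.t_nonneg) (fun p => p.t_le)
  have hB : IsSmoothO (fun _ => 1) fun (p : ParabolicSample m T R) x => m.B (p.u x p.t) :=
    hu.comp m.smooth_B
  have h1 : IsSmoothO (fun p => p.h ^ 2) fun (p : ParabolicSample m T R) x =>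
      ∑ l, m.lam l * (stencil (upwindCoeff (m.lam l)) (upwindNode (m.lam l)) p.h
        (fun y => m.maxw l (p.u y p.t)) x - deriv (fun y => m.maxw l (p.u y p.t)) x) :=
    IsSmoothO.sum Finset.univ fun l _ => (((hu.comp (m.smooth_maxw l)).stencil_sub_deriv
      (isSecondOrderStencil_upwind _) hh).mono 1 fun p => by simp).const_mul _
  -- `D D B - B'' = D (D B - B') + (D B' - B'')`; applying `D` to the first defect costs a
  -- derivative but no power of `h`.
  have h2 := ((hB.stencil_sub_deriv hc hh).stencil hc hh).add (hB.deriv.stencil_sub_deriv hc hh)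
  obtain ⟨C₁, hC₁⟩ := h1.bound
  obtain ⟨C₂, hC₂⟩ := h2.bound
  refine ⟨|R 2| + |C₁| + |C₂|, fun p x₀ Δt i hΔt hΔT => ?_⟩
  have b1 := hC₁ p (x₀ + i * p.h)
  have b2 := hC₂ p (x₀ + i * p.h)
  set x := x₀ + i * p.h
  have b3 := p.hasDerivBounds.abs_time_taylor_le p.isParabolicSolution.1 p.t_nonneg hΔt hΔT x
  rw [p.isParabolicSolution.time_deriv p.t_nonneg p.t_le,
    m.deriv_A_comp (contDiff_space p.isParabolicSolution.1 p.t)] at b3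
  rw [stencil_sub, sub_add_sub_cancel] at b2
  simp only [mul_sub, Finset.sum_sub_distrib] at b1
  rw [iteratedDeriv_succ, iteratedDeriv_one] at b3
  have e : truncationError x₀ p.h Δt p.u (p.t + Δt)
        (m.limitStep Δt p.h (sampleAt x₀ p.h (fun x => p.u x p.t))) i
      = ((p.u x (p.t + Δt) - p.u x p.t) / Δt - (deriv (deriv fun y => m.B (p.u y p.t)) x
          - ∑ l, m.lam l * deriv (fun y => m.maxw l (p.u y p.t)) x))
        + (∑ l, m.lam l * stencil (upwindCoeff (m.lam l)) (upwindNode (m.lam l)) p.h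
              (fun y => m.maxw l (p.u y p.t)) x
            - ∑ l, m.lam l * deriv (fun y => m.maxw l (p.u y p.t)) x)
        - (stencil centeredCoeff centeredNode p.h
              (stencil centeredCoeff centeredNode p.h fun y => m.B (p.u y p.t)) x
            - deriv (deriv fun y => m.B (p.u y p.t)) x) := by
    simp only [truncationError, m.limitStep_sampleAt]
    simp only [sampleAt]
    field_simp
    ring
  have hsq := sq_nonneg p.h
  have b1' : C₁ * p.h ^ 2 ≤ |C₁| * (Δt + p.h ^ 2) :=
    (mul_le_mul_of_nonneg_right (le_abs_self _) hsq).trans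
      (mul_le_mul_of_nonneg_left (by linarith) (abs_nonneg _))
  have b2' : C₂ * (1 * p.h ^ 2) ≤ |C₂| * (Δt + p.h ^ 2) := by
    rw [one_mul]
    exact (mul_le_mul_of_nonneg_right (le_abs_self _) hsq).trans
      (mul_le_mul_of_nonneg_left (by linarith) (abs_nonneg _))
  have b3' : R 2 * Δt ≤ |R 2| * (Δt + p.h ^ 2) :=
    (mul_le_mul_of_nonneg_right (le_abs_self _) hΔt.le).trans
      (mul_le_mul_of_nonneg_left (by linarith) (abs_nonneg _))
  rw [e]
  refine (abs_sub _ _).trans ((add_le_add ((abs_add_le _ _).trans (add_le_add (b3.trans b3')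
    (b1.trans b1'))) (b2.trans b2')).trans (le_of_eq (by ring)))

end KineticModel

end

/-! ### The limit `ε → 0` on a fixed grid -/

noncomputable section

open Filter Asymptotics

section RightLimit

theorem Asymptotics.IsBigO.of_pos_eq {f g w : ℝ → ℝ} (h : g =O[𝓝[>] 0] w)
    (e : ∀ ε, 0 < ε → f ε = g ε) : f =O[𝓝[>] 0] w :=
  h.congr' (eventually_nhdsWithin_of_forall fun ε hε => (e ε hε).symm) EventuallyEq.rfl

theorem Filter.Tendsto.of_pos_eq {f g : ℝ → ℝ} {a : ℝ} (h : Tendsto g (𝓝[>] 0) (𝓝 a))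
    (e : ∀ ε, 0 < ε → f ε = g ε) : Tendsto f (𝓝[>] 0) (𝓝 a) :=
  h.congr' (eventually_nhdsWithin_of_forall fun ε hε => (e ε hε).symm)

theorem tendsto_id_right : Tendsto (fun ε : ℝ => ε) (𝓝[>] 0) (𝓝 0) :=
  tendsto_id.mono_left nhdsWithin_le_nhds

theorem tendsto_sqrt_right : Tendsto (fun ε : ℝ => √ε) (𝓝[>] 0) (𝓝 0) := by
  simpa using ((Real.continuous_sqrt.tendsto 0).mono_left nhdsWithin_le_nhds :
    Tendsto (fun ε : ℝ => √ε) (𝓝[>] 0) _)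

theorem isBigO_id_sqrt_right : (fun ε : ℝ => ε) =O[𝓝[>] 0] fun ε => √ε := by
  have h := (isBigO_refl (fun ε : ℝ => √ε) (𝓝[>] 0)).mul (tendsto_sqrt_right.isBigO_one ℝ)
  simp only [mul_one] at h
  exact h.of_pos_eq fun ε hε => (Real.mul_self_sqrt hε.le).symm

theorem isBigO_sqrt_mul_sqrt_right {f g : ℝ → ℝ} (hf : f =O[𝓝[>] 0] fun ε => √ε)
    (hg : g =O[𝓝[>] 0] fun ε => √ε) : (fun ε => f ε * g ε) =O[𝓝[>] 0] fun ε => ε :=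
  (hf.mul hg).trans ((isBigO_refl (fun ε : ℝ => ε) _).of_pos_eq
    fun _ hε => Real.mul_self_sqrt hε.le)

/-- Strict differentiability at the common limit `c` gives a Lipschitz bound near it. -/
theorem isBigO_comp_sub {F : ℝ → ℝ} (hF : ContDiff ℝ ∞ F) {a b : ℝ → ℝ} {c : ℝ}
    (ha : Tendsto a (𝓝[>] 0) (𝓝 c)) (hb : Tendsto b (𝓝[>] 0) (𝓝 c)) :
    (fun ε => F (a ε) - F (b ε)) =O[𝓝[>] 0] fun ε => a ε - b ε := by
  have h := (hF.contDiffAt (x := c)).hasStrictFDerivAt (by simp)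
  exact h.isBigO_sub.comp_tendsto (ha.prodMk_nhds hb)

end RightLimit

section GridDifference

/-- Centered difference quotient of a grid function. -/
def gridCentered (h : ℝ) (a : ℤ → ℝ) (i : ℤ) : ℝ := (a (i + 1) - a (i - 1)) / (2 * h)

/-- Second-order upwind difference quotient of a grid function. -/
def gridUpwind (γ h : ℝ) (a : ℤ → ℝ) (i : ℤ) : ℝ := (upwindFlux γ a i - upwindFlux γ a (i - 1)) / h

variable {a b : ℝ → ℤ → ℝ} {w : ℝ → ℝ}

theorem gridCentered_sub (h : ℝ) (a b : ℤ → ℝ) (i : ℤ) :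
    gridCentered h (fun j => a j - b j) i = gridCentered h a i - gridCentered h b i := by
  simp only [gridCentered]; ring

theorem gridCentered_const_mul (h c : ℝ) (a : ℤ → ℝ) (i : ℤ) :
    gridCentered h (fun j => c * a j) i = c * gridCentered h a i := by
  simp only [gridCentered]; ring

theorem isBigO_gridCentered (h : ℝ) (ha : ∀ i, (fun ε => a ε i) =O[𝓝[>] 0] w) (i : ℤ) :
    (fun ε => gridCentered h (a ε) i) =O[𝓝[>] 0] w := by
  simp only [gridCentered, div_eq_inv_mul]
  exact ((ha _).sub (ha _)).const_mul_left _

theorem tendsto_gridCentered (h : ℝ) {A : ℤ → ℝ}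
    (ha : ∀ i, Tendsto (fun ε => a ε i) (𝓝[>] 0) (𝓝 (A i))) (i : ℤ) :
    Tendsto (fun ε => gridCentered h (a ε) i) (𝓝[>] 0) (𝓝 (gridCentered h A i)) :=
  ((ha _).sub (ha _)).div_const _

theorem isBigO_gridUpwind (γ h : ℝ) (ha : ∀ i, (fun ε => a ε i) =O[𝓝[>] 0] w) (i : ℤ) :
    (fun ε => gridUpwind γ h (a ε) i) =O[𝓝[>] 0] w := by
  simp only [gridUpwind, upwindFlux, div_eq_inv_mul]
  split_ifs <;>
  exact ((((((ha _).const_mul_left _).sub (ha _)).const_mul_left _).const_mul_left _).sub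
    (((((ha _).const_mul_left _).sub (ha _)).const_mul_left _).const_mul_left _)).const_mul_left _

theorem tendsto_gridUpwind (γ h : ℝ) {A : ℤ → ℝ}
    (ha : ∀ i, Tendsto (fun ε => a ε i) (𝓝[>] 0) (𝓝 (A i))) (i : ℤ) :
    Tendsto (fun ε => gridUpwind γ h (a ε) i) (𝓝[>] 0) (𝓝 (gridUpwind γ h A i)) := by
  simp only [gridUpwind, upwindFlux]
  split_ifs <;>
  exact ((((((ha _).const_mul _).sub (ha _)).div_const _).const_mul _).sub
    (((((ha _).const_mul _).sub (ha _)).div_const _).const_mul _)).div_const _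

end GridDifference

variable {J : ℕ}

/-- Sum of the two diffusive components. -/
def diffusiveSum (f : KineticGrid J) (i : ℤ) : ℝ := f (Sum.inr 0) i + f (Sum.inr 1) i

/-- Difference of the two diffusive components. -/
def diffusiveDiff (f : KineticGrid J) (i : ℤ) : ℝ := f (Sum.inr 1) i - f (Sum.inr 0) i

namespace KineticModel

variable (m : KineticModel J)

theorem isBigO_mul_diffSpeed : (fun ε => ε * m.diffSpeed ε) =O[𝓝[>] 0] fun ε => √ε := by
  refine IsBigO.of_bound (m.mu + m.theta) ?_
  filter_upwards [Ioc_mem_nhdsGT (zero_lt_one' ℝ)] with ε hε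
  have h := mul_le_mul_of_nonneg_right (m.diffSpeed_mul_sqrt_le hε.1 hε.2) (Real.sqrt_nonneg ε)
  rw [mul_assoc, Real.mul_self_sqrt hε.1.le, mul_comm (m.diffSpeed ε)] at h
  rwa [Real.norm_eq_abs, Real.norm_eq_abs,
    abs_of_nonneg (mul_nonneg hε.1.le (m.diffSpeed_nonneg _)), abs_of_nonneg (Real.sqrt_nonneg _)]

theorem isBigO_diffSpeed_mul {a : ℝ → ℝ} (ha : a =O[𝓝[>] 0] fun ε => √ε) :
    (fun ε => m.diffSpeed ε * a ε) =O[𝓝[>] 0] fun _ => (1 : ℝ) := by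
  refine ((isBigO_refl m.diffSpeed _).mul ha).trans (IsBigO.of_bound (m.mu + m.theta) ?_)
  filter_upwards [Ioc_mem_nhdsGT (zero_lt_one' ℝ)] with ε hε
  rw [Real.norm_eq_abs, abs_of_nonneg (mul_nonneg (m.diffSpeed_nonneg _) (Real.sqrt_nonneg _)),
    norm_one, mul_one]
  exact m.diffSpeed_mul_sqrt_le hε.1 hε.2

theorem tendsto_mul_diffSpeed_sq :
    Tendsto (fun ε => ε * m.diffSpeed ε ^ 2) (𝓝[>] 0) (𝓝 (m.theta ^ 2)) := by
  have h := ((tendsto_sqrt_right.const_mul (m.mu / √2)).add_const m.theta).pow 2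
  simp only [mul_zero, zero_add] at h
  refine h.of_pos_eq fun ε hε => ?_
  rw [← m.diffSpeed_mul_sqrt hε, mul_pow, Real.sq_sqrt hε.le]; ring

theorem convection_inl (ε h : ℝ) (f : KineticGrid J) (l : Fin J) (i : ℤ) :
    m.convection ε h f (Sum.inl l) i = gridUpwind (m.lam l) h (f (Sum.inl l)) i := rfl

theorem convection_inr (ε h : ℝ) (f : KineticGrid J) (k : Fin 2) (i : ℤ) :
    m.convection ε h f (Sum.inr k) i
      = m.velocity ε (Sum.inr k) * gridCentered h (f (Sum.inr k)) i := by
  simp only [convection, flux, Sum.elim_inr, centeredFlux, gridCentered, sub_add_cancel]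
  ring

theorem sum_convection (ε h : ℝ) (f : KineticGrid J) (i : ℤ) :
    ∑ l, m.convection ε h f l i = ∑ l, gridUpwind (m.lam l) h (f (Sum.inl l)) i
      + m.diffSpeed ε * gridCentered h (diffusiveDiff f) i := by
  simp only [Fintype.sum_sum_type, Fin.sum_univ_two, convection_inl, convection_inr,
    m.velocity_inr_zero, m.velocity_inr_one]
  simp only [gridCentered, diffusiveDiff]
  ring

theorem innerStep_inl {ε : ℝ} (hε : 0 < ε) (h : ℝ) (f : KineticGrid J) (l : Fin J) (i : ℤ) :
    m.innerStep ε ε h f (Sum.inl l) i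
      = m.maxw l (gridDensity f i) - ε * gridUpwind (m.lam l) h (f (Sum.inl l)) i :=
  m.innerStep_self hε h f (Sum.inl l) i

theorem diffusiveSum_innerStep {ε : ℝ} (hε : 0 < ε) (h : ℝ) (f : KineticGrid J) (i : ℤ) :
    diffusiveSum (m.innerStep ε ε h f) i = 1 / m.theta ^ 2 * m.B (gridDensity f i)
      - ε * m.diffSpeed ε * gridCentered h (diffusiveDiff f) i := by
  have := m.theta_pos.ne'
  simp only [diffusiveSum, m.innerStep_self hε, convection_inr, m.velocity_inr_zero,
    m.velocity_inr_one, maxwellian, Sum.elim_inr]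
  simp only [gridCentered, diffusiveDiff]
  field_simp
  ring

theorem diffusiveDiff_innerStep {ε : ℝ} (hε : 0 < ε) (h : ℝ) (f : KineticGrid J) (i : ℤ) :
    diffusiveDiff (m.innerStep ε ε h f) i
      = -(ε * m.diffSpeed ε * gridCentered h (diffusiveSum f) i) := by
  simp only [diffusiveDiff, m.innerStep_self hε, convection_inr, m.velocity_inr_zero,
    m.velocity_inr_one, maxwellian, Sum.elim_inr]
  simp only [gridCentered, diffusiveSum]
  ring

end KineticModel

/-- Kinetic grid data, depending on `ε`, that stay bounded at each grid point as `ε → 0` and whose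
density converges to `U`. -/
structure IsBoundedFamily (f : ℝ → KineticGrid J) (U : ℤ → ℝ) : Prop where
  density : ∀ i, Tendsto (fun ε => gridDensity (f ε) i) (𝓝[>] 0) (𝓝 (U i))
  transport : ∀ l i, (fun ε => f ε (Sum.inl l) i) =O[𝓝[>] 0] fun _ => (1 : ℝ)
  diffusive_sum : ∀ i, (fun ε => diffusiveSum (f ε) i) =O[𝓝[>] 0] fun _ => (1 : ℝ)
  diffusive_diff : ∀ i, (fun ε => diffusiveDiff (f ε) i) =O[𝓝[>] 0] fun _ => (1 : ℝ)

/-- Kinetic grid data, depending on `ε`, that converge to the local equilibrium of density `U`. -/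
structure IsRelaxedFamily (m : KineticModel J) (f : ℝ → KineticGrid J) (U : ℤ → ℝ) : Prop where
  density : ∀ i, Tendsto (fun ε => gridDensity (f ε) i) (𝓝[>] 0) (𝓝 (U i))
  transport : ∀ l i, Tendsto (fun ε => f ε (Sum.inl l) i) (𝓝[>] 0) (𝓝 (m.maxw l (U i)))
  diffusive_sum : ∀ i,
    Tendsto (fun ε => diffusiveSum (f ε) i) (𝓝[>] 0) (𝓝 (1 / m.theta ^ 2 * m.B (U i)))
  diffusive_diff : ∀ i, (fun ε => diffusiveDiff (f ε) i) =O[𝓝[>] 0] fun ε => √ε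

variable {m : KineticModel J} {f : ℝ → KineticGrid J} {U : ℤ → ℝ}

theorem IsRelaxedFamily.isBoundedFamily (hf : IsRelaxedFamily m f U) : IsBoundedFamily f U where
  density := hf.density
  transport l i := (hf.transport l i).isBigO_one ℝ
  diffusive_sum i := (hf.diffusive_sum i).isBigO_one ℝ
  diffusive_diff i := (hf.diffusive_diff i).trans (tendsto_sqrt_right.isBigO_one ℝ)

/-- For bounded data the diffusive flux contributes `ε c · O(1) = O(√ε)`. The relaxed version below
reaches `O(ε)`, since there `c d` is bounded. -/
theorem IsBoundedFamily.isBigO_density_sub (hf : IsBoundedFamily f U) (h : ℝ) (i : ℤ) :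
    (fun ε => gridDensity (m.innerStep ε ε h (f ε)) i - gridDensity (f ε) i)
      =O[𝓝[>] 0] fun ε => √ε := by
  have h1 : (fun ε => ∑ l, gridUpwind (m.lam l) h (f ε (Sum.inl l)) i)
      =O[𝓝[>] 0] fun _ => (1 : ℝ) :=
    IsBigO.fun_sum fun l _ => isBigO_gridUpwind _ h (hf.transport l) i
  have h2 := isBigO_id_sqrt_right.mul h1
  have h3 := m.isBigO_mul_diffSpeed.mul (isBigO_gridCentered h hf.diffusive_diff i)
  simp only [mul_one] at h2 h3
  refine (h2.add h3).neg_left.of_pos_eq fun ε hε => ?_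
  rw [m.gridDensity_innerStep hε, m.sum_convection]; ring

theorem IsRelaxedFamily.isBigO_density_sub (hf : IsRelaxedFamily m f U) (h : ℝ) (i : ℤ) :
    (fun ε => gridDensity (m.innerStep ε ε h (f ε)) i - gridDensity (f ε) i)
      =O[𝓝[>] 0] fun ε => ε := by
  have h1 : (fun ε => ∑ l, gridUpwind (m.lam l) h (f ε (Sum.inl l)) i)
      =O[𝓝[>] 0] fun _ => (1 : ℝ) :=
    IsBigO.fun_sum fun l _ => isBigO_gridUpwind _ h (hf.isBoundedFamily.transport l) i
  have h2 := (isBigO_refl (fun ε : ℝ => ε) (𝓝[>] 0)).mul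
    (h1.add (m.isBigO_diffSpeed_mul (isBigO_gridCentered h hf.diffusive_diff i)))
  simp only [mul_one] at h2
  refine h2.neg_left.of_pos_eq fun ε hε => ?_
  rw [m.gridDensity_innerStep hε, m.sum_convection]; ring

/-- One step replaces the data by Maxwellians of a convergent density, plus `O(√ε)`. The Maxwellians
cancel in `d`, leaving `-ε c D s` with `s` bounded. -/
theorem IsBoundedFamily.innerStep (hf : IsBoundedFamily f U) (h : ℝ) :
    IsRelaxedFamily m (fun ε => m.innerStep ε ε h (f ε)) U where
  density i := by
    have := ((hf.isBigO_density_sub (m := m) h i).trans_tendsto tendsto_sqrt_right).add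
      (hf.density i)
    simpa using this
  transport l i := by
    have h1 := (isBigO_refl (fun ε : ℝ => ε) (𝓝[>] 0)).mul
      (isBigO_gridUpwind (m.lam l) h (hf.transport l) i)
    simp only [mul_one] at h1
    have h2 := (((m.smooth_maxw l).continuous.tendsto _).comp (hf.density i)).sub
      (h1.trans_tendsto tendsto_id_right)
    rw [sub_zero] at h2
    exact h2.of_pos_eq fun ε hε => m.innerStep_inl hε h _ l i
  diffusive_sum i := by
    have h1 := m.isBigO_mul_diffSpeed.mul (isBigO_gridCentered h hf.diffusive_diff i)
    simp only [mul_one] at h1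
    have h2 := (((m.smooth_B.continuous.tendsto _).comp (hf.density i)).const_mul
      (1 / m.theta ^ 2)).sub (h1.trans_tendsto tendsto_sqrt_right)
    rw [sub_zero] at h2
    exact h2.of_pos_eq fun ε hε => m.diffusiveSum_innerStep hε h _ i
  diffusive_diff i := by
    have h1 := m.isBigO_mul_diffSpeed.mul (isBigO_gridCentered h hf.diffusive_sum i)
    simp only [mul_one] at h1
    exact h1.neg_left.of_pos_eq fun ε hε => m.diffusiveDiff_innerStep hε h _ i

theorem IsBoundedFamily.innerStep_iterate (hf : IsBoundedFamily f U) (h : ℝ) (k : ℕ) :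
    IsBoundedFamily (fun ε => (m.innerStep ε ε h)^[k] (f ε)) U := by
  induction k with
  | zero => exact hf
  | succ k ih =>
    simp only [Function.iterate_succ_apply']
    exact (ih.innerStep (m := m) h).isBoundedFamily

theorem IsBoundedFamily.isBigO_diffusiveSum_sub (hf : IsBoundedFamily f U) (h : ℝ) (i : ℤ) :
    (fun ε => diffusiveSum (m.innerStep ε ε h (m.innerStep ε ε h (f ε))) i
      - diffusiveSum (m.innerStep ε ε h (f ε)) i) =O[𝓝[>] 0] fun ε => √ε := by
  have hg := hf.innerStep (m := m) h
  have h1 := ((isBigO_comp_sub m.smooth_B (hg.density i) (hf.density i)).trans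
    (hf.isBigO_density_sub h i)).const_mul_left (1 / m.theta ^ 2)
  have h2 := m.isBigO_mul_diffSpeed.mul (isBigO_gridCentered h
    (a := fun ε j => diffusiveDiff (m.innerStep ε ε h (f ε)) j - diffusiveDiff (f ε) j)
    (fun j => (hg.isBoundedFamily.diffusive_diff j).sub (hf.diffusive_diff j)) i)
  simp only [mul_one] at h2
  refine (h1.sub h2).of_pos_eq fun ε hε => ?_
  rw [m.diffusiveSum_innerStep hε, m.diffusiveSum_innerStep hε, gridCentered_sub]
  ring

/-- Both factors of `ε c · D d` are now `O(√ε)`, and the density increment entering `B` is `O(ε)`.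
-/
theorem IsRelaxedFamily.isBigO_diffusiveSum_sub (hf : IsRelaxedFamily m f U) (h : ℝ) (i : ℤ) :
    (fun ε => diffusiveSum (m.innerStep ε ε h (m.innerStep ε ε h (f ε))) i
      - diffusiveSum (m.innerStep ε ε h (f ε)) i) =O[𝓝[>] 0] fun ε => ε := by
  have hg := hf.isBoundedFamily.innerStep (m := m) h
  have h1 := ((isBigO_comp_sub m.smooth_B (hg.density i) (hf.density i)).trans
    (hf.isBigO_density_sub h i)).const_mul_left (1 / m.theta ^ 2)
  have h2 := isBigO_sqrt_mul_sqrt_right m.isBigO_mul_diffSpeed (isBigO_gridCentered h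
    (a := fun ε j => diffusiveDiff (m.innerStep ε ε h (f ε)) j - diffusiveDiff (f ε) j)
    (fun j => (hg.diffusive_diff j).sub (hf.diffusive_diff j)) i)
  refine (h1.sub h2).of_pos_eq fun ε hε => ?_
  rw [m.diffusiveSum_innerStep hε, m.diffusiveSum_innerStep hε, gridCentered_sub]
  ring

theorem IsRelaxedFamily.isBigO_transport_sub (hf : IsRelaxedFamily m f U) (h : ℝ) (l : Fin J)
    (i : ℤ) :
    (fun ε => m.innerStep ε ε h (m.innerStep ε ε h (f ε)) (Sum.inl l) i
      - m.innerStep ε ε h (f ε) (Sum.inl l) i) =O[𝓝[>] 0] fun ε => ε := by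
  have hg := hf.isBoundedFamily.innerStep (m := m) h
  have h1 := (isBigO_comp_sub (m.smooth_maxw l) (hg.density i) (hf.density i)).trans
    (hf.isBigO_density_sub h i)
  have h2 := (isBigO_refl (fun ε : ℝ => ε) (𝓝[>] 0)).mul
    ((isBigO_gridUpwind (m.lam l) h (hg.isBoundedFamily.transport l) i).sub
      (isBigO_gridUpwind (m.lam l) h (hf.isBoundedFamily.transport l) i))
  simp only [mul_one] at h2
  refine (h1.sub h2).of_pos_eq fun ε hε => ?_
  rw [m.innerStep_inl hε, m.innerStep_inl hε]
  ring

/-- The increment of `d` is `-ε c D` applied to the preceding increment of `s`, and each factor is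
`O(√ε)`. -/
theorem IsBoundedFamily.isBigO_diffusiveDiff_sub (hf : IsBoundedFamily f U) (h : ℝ) (i : ℤ) :
    (fun ε => diffusiveDiff (m.innerStep ε ε h (m.innerStep ε ε h (m.innerStep ε ε h (f ε)))) i
      - diffusiveDiff (m.innerStep ε ε h (m.innerStep ε ε h (f ε))) i)
      =O[𝓝[>] 0] fun ε => ε := by
  have h2 := isBigO_sqrt_mul_sqrt_right m.isBigO_mul_diffSpeed (isBigO_gridCentered h
    (a := fun ε j => diffusiveSum (m.innerStep ε ε h (m.innerStep ε ε h (f ε))) j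
      - diffusiveSum (m.innerStep ε ε h (f ε)) j) (hf.isBigO_diffusiveSum_sub h) i)
  refine h2.neg_left.of_pos_eq fun ε hε => ?_
  rw [m.diffusiveDiff_innerStep hε, m.diffusiveDiff_innerStep hε, gridCentered_sub]
  ring

/-- After two inner steps the convective rate of change converges to the one of the limiting
scheme. -/
theorem IsRelaxedFamily.tendsto_sum_convection (hf : IsRelaxedFamily m f U) (h : ℝ) (i : ℤ) :
    Tendsto (fun ε => ∑ l, m.convection ε h (m.innerStep ε ε h (f ε)) l i) (𝓝[>] 0)
      (𝓝 (∑ l, gridUpwind (m.lam l) h (fun j => m.maxw l (U j)) i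
        - gridCentered h (gridCentered h fun j => m.B (U j)) i)) := by
  have hg := hf.isBoundedFamily.innerStep (m := m) h
  have hθ := m.theta_pos.ne'
  have h1 : Tendsto (fun ε => ∑ l, gridUpwind (m.lam l) h (m.innerStep ε ε h (f ε) (Sum.inl l)) i)
      (𝓝[>] 0) (𝓝 (∑ l, gridUpwind (m.lam l) h (fun j => m.maxw l (U j)) i)) :=
    tendsto_finsetSum _ fun l _ => tendsto_gridUpwind _ h (hg.transport l) i
  have h2 := m.tendsto_mul_diffSpeed_sq.mul (tendsto_gridCentered h (fun j =>
    tendsto_gridCentered h hf.diffusive_sum j) i)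
  have e : m.theta ^ 2 * gridCentered h (gridCentered h fun j => 1 / m.theta ^ 2 * m.B (U j)) i
      = gridCentered h (gridCentered h fun j => m.B (U j)) i := by
    have : (gridCentered h fun j => 1 / m.theta ^ 2 * m.B (U j))
        = fun j => 1 / m.theta ^ 2 * gridCentered h (fun j => m.B (U j)) j := by
      funext j; rw [gridCentered_const_mul]
    rw [this, gridCentered_const_mul]
    field_simp
  rw [e] at h2
  refine (h1.sub h2).of_pos_eq fun ε hε => ?_
  have e2 : diffusiveDiff (m.innerStep ε ε h (f ε))
      = fun j => (-(ε * m.diffSpeed ε)) * gridCentered h (diffusiveSum (f ε)) j := by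
    funext j; rw [m.diffusiveDiff_innerStep hε]; ring
  rw [m.sum_convection, e2, gridCentered_const_mul]
  change _ = _ - ε * m.diffSpeed ε ^ 2 * gridCentered h (gridCentered h (diffusiveSum (f ε))) i
  ring

theorem limitStep_eq (Δt h : ℝ) (U : ℤ → ℝ) (i : ℤ) :
    m.limitStep Δt h U i = U i - Δt * (∑ l, gridUpwind (m.lam l) h (fun j => m.maxw l (U j)) i
      - gridCentered h (gridCentered h fun j => m.B (U j)) i) := by
  have e : gridCentered h (gridCentered h fun j => m.B (U j)) i
      = (m.B (U (i + 2)) - 2 * m.B (U i) + m.B (U (i - 2))) / (4 * h ^ 2) := by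
    have e1 : i + 1 + 1 = i + 2 := by ring
    have e2 : i - 1 - 1 = i - 2 := by ring
    simp only [gridCentered, add_sub_cancel_right, sub_add_cancel, e1, e2]
    ring
  rw [e]
  simp only [KineticModel.limitStep, gridUpwind]
  ring

/-- Here `c` stands for `Δt - (K + 1) ε`, and `a`, `b` for the last two inner values of a quantity.
Boundedness survives the division by `ε` because their difference is `O(ε)`. -/
theorem isBigO_extrapolation {a b c : ℝ → ℝ} (hc : c =O[𝓝[>] 0] fun _ => (1 : ℝ))
    (ha : a =O[𝓝[>] 0] fun _ => (1 : ℝ)) (hab : (fun ε => a ε - b ε) =O[𝓝[>] 0] fun ε => ε) :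
    (fun ε => a ε + c ε * ((a ε - b ε) / ε)) =O[𝓝[>] 0] fun _ => (1 : ℝ) := by
  have h1 : (fun ε => (a ε - b ε) / ε) =O[𝓝[>] 0] fun _ => (1 : ℝ) := by
    have h := hab.mul (isBigO_refl (fun ε : ℝ => ε⁻¹) (𝓝[>] 0))
    have h' : (fun ε : ℝ => ε * ε⁻¹) =O[𝓝[>] 0] fun _ => (1 : ℝ) :=
      (isBigO_refl (fun _ => (1 : ℝ)) _).of_pos_eq fun ε hε => mul_inv_cancel₀ hε.ne'
    simpa only [div_eq_mul_inv] using h.trans h'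
  have h2 := hc.mul h1
  simp only [mul_one] at h2
  exact ha.add h2

/-- One projective step maps bounded families to bounded families, and acts on the limits of the
densities as the limiting scheme. -/
theorem IsBoundedFamily.pfeStep (hf : IsBoundedFamily f U) {K : ℕ} (hK : 2 ≤ K) (Δt h : ℝ) :
    IsBoundedFamily (fun ε => m.pfeStep K ε ε Δt h (f ε)) (m.limitStep Δt h U) := by
  -- With `K = k + 2`, the state after `k` steps is bounded and the one after `k + 1` is relaxed.
  -- The rate at step `K` therefore converges, and the increment from `K` to `K + 1` is `O(ε)`.
  obtain ⟨k, rfl⟩ := Nat.exists_eq_add_of_le' hK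
  have h1 := hf.innerStep_iterate (m := m) h k
  have h2 := h1.innerStep (m := m) h
  have h3 := h2.isBoundedFamily.innerStep (m := m) h
  have h4 := h3.isBoundedFamily.innerStep (m := m) h
  have hc : Tendsto (fun ε : ℝ => Δt - ((k + 2 : ℕ) + 1) * ε) (𝓝[>] 0) (𝓝 Δt) := by
    simpa using (tendsto_id_right.const_mul (((k + 2 : ℕ) : ℝ) + 1)).const_sub Δt
  have hc1 := hc.isBigO_one ℝ
  have i3 : ∀ ε, (m.innerStep ε ε h)^[k + 2] (f ε) =
      m.innerStep ε ε h (m.innerStep ε ε h ((m.innerStep ε ε h)^[k] (f ε))) := fun ε => by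
    rw [Function.iterate_succ_apply', Function.iterate_succ_apply']
  have i4 : ∀ ε, (m.innerStep ε ε h)^[k + 2 + 1] (f ε) = m.innerStep ε ε h
      (m.innerStep ε ε h (m.innerStep ε ε h ((m.innerStep ε ε h)^[k] (f ε)))) := fun ε => by
    rw [Function.iterate_succ_apply', i3]
  refine ⟨fun i => ?_, fun l i => ?_, fun i => ?_, fun i => ?_⟩
  · rw [limitStep_eq]
    refine ((h4.density i).sub (hc.mul (h2.tendsto_sum_convection h i))).of_pos_eq fun ε hε => ?_
    rw [m.gridDensity_pfeStep, i3, i4,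
      m.gridDensity_innerStep hε h (m.innerStep ε ε h (m.innerStep ε ε h _))]
    field_simp
    ring
  · simp only [KineticModel.pfeStep, i3, i4]
    exact isBigO_extrapolation hc1 (h4.isBoundedFamily.transport l i)
      (h2.isBigO_transport_sub h l i)
  · refine (isBigO_extrapolation hc1 (h4.isBoundedFamily.diffusive_sum i)
      (h2.isBigO_diffusiveSum_sub h i)).of_pos_eq fun ε _ => ?_
    simp only [diffusiveSum, KineticModel.pfeStep, i3, i4]
    ring
  · refine (isBigO_extrapolation hc1 (h4.isBoundedFamily.diffusive_diff i)
      (h1.isBigO_diffusiveDiff_sub h i)).of_pos_eq fun ε _ => ?_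
    simp only [diffusiveDiff, KineticModel.pfeStep, i3, i4]
    ring

theorem IsBoundedFamily.pfeStep_iterate (hf : IsBoundedFamily f U) {K : ℕ} (hK : 2 ≤ K)
    (Δt h : ℝ) (n : ℕ) :
    IsBoundedFamily (fun ε => (m.pfeStep K ε ε Δt h)^[n] (f ε)) ((m.limitStep Δt h)^[n] U) := by
  induction n with
  | zero => exact hf
  | succ n ih =>
    simp only [Function.iterate_succ_apply']
    exact ih.pfeStep hK Δt h

theorem isBoundedFamily_of_abs_le (hU : ∀ ε : ℝ, 0 < ε → ε ≤ 1 → gridDensity (f ε) = U)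
    (hb : ∀ l i, ∃ b : ℝ, ∀ ε : ℝ, 0 < ε → ε ≤ 1 → |f ε l i| ≤ b) : IsBoundedFamily f U := by
  have hev : ∀ᶠ ε : ℝ in 𝓝[>] 0, 0 < ε ∧ ε ≤ 1 := Ioc_mem_nhdsGT zero_lt_one
  have hO : ∀ l i, (fun ε => f ε l i) =O[𝓝[>] 0] fun _ => (1 : ℝ) := fun l i => by
    obtain ⟨b, hb⟩ := hb l i
    refine IsBigO.of_bound b ?_
    filter_upwards [hev] with ε hε
    simpa using hb ε hε.1 hε.2
  refine ⟨fun i => tendsto_const_nhds.congr' ?_, fun l i => hO _ i,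
    fun i => (hO _ i).add (hO _ i), fun i => (hO _ i).sub (hO _ i)⟩
  filter_upwards [hev] with ε hε
  rw [hU ε hε.1 hε.2]

end

/-! ### The consistency theorem -/

theorem mainTheorem2 {J : ℕ} (m : KineticModel J) (K : ℕ) (hK : 2 ≤ K) (T : ℝ) (hT : 0 < T)
    (R : ℕ → ℝ) (κ₁ κ₂ : ℝ) (hκ₁ : 0 < κ₁) (hκ₂ : κ₁ ≤ κ₂) :
    -- truncation error with respect to the exact density of the kinetic model
    (∃ C : ℝ, ∀ ε : ℝ, 0 < ε → ε ≤ 1 →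
      ∀ f : Fin J ⊕ Fin 2 → ℝ → ℝ → ℝ, m.IsKineticSolution ε T f →
        (∀ l, HasDerivBounds T R (f l)) →
      ∀ (x₀ Δx Δt : ℝ) (N : ℕ), 0 < Δx → κ₁ * Δx ^ 2 ≤ Δt → Δt ≤ κ₂ * Δx ^ 2 →
        (N + 1) * Δt ≤ T → ∀ i : ℤ,
        |truncationError x₀ Δx Δt (fun x t => ∑ l, f l x t) ((N + 1) * Δt)
            (gridDensity (m.pfeStep K ε ε Δt Δx
              (fun l => sampleAt x₀ Δx (fun x => f l x (N * Δt))))) i|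
          ≤ C * (ε + Δt + ε ^ 2 / Δt)) ∧
    -- truncation error with respect to the exact solution of the parabolic equation
    (∃ C : ℝ, ∀ ε : ℝ, 0 < ε → ε ≤ 1 →
      ∀ u : ℝ → ℝ → ℝ, m.IsParabolicSolution T u → HasDerivBounds T R u →
      ∀ (x₀ Δx Δt : ℝ) (N : ℕ), 0 < Δx → κ₁ * Δx ^ 2 ≤ Δt → Δt ≤ κ₂ * Δx ^ 2 →
        (N + 1) * Δt ≤ T →
      ∀ φ : Fin J ⊕ Fin 2 → ℝ → ℝ, m.IsChapmanEnskogState ε R (fun x => u x (N * Δt)) φ →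
        ∀ i : ℤ,
        |truncationError x₀ Δx Δt u ((N + 1) * Δt)
            (gridDensity (m.pfeStep K ε ε Δt Δx (fun l => sampleAt x₀ Δx (φ l)))) i|
          ≤ C * (ε + m.mu * √ε + Δt + ε ^ 2 / Δt)) ∧
    -- the limiting scheme as `ε → 0` on a fixed grid
    (∀ Δx Δt : ℝ, 0 < Δx → 0 < Δt → ∀ (U₀ : ℤ → ℝ) (F₀ : ℝ → KineticGrid J),
      (∀ ε : ℝ, 0 < ε → ε ≤ 1 → gridDensity (F₀ ε) = U₀) →
      (∀ l i, ∃ b : ℝ, ∀ ε : ℝ, 0 < ε → ε ≤ 1 → |F₀ ε l i| ≤ b) →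
      ∀ (n : ℕ) (i : ℤ),
        Filter.Tendsto (fun ε => gridDensity ((m.pfeStep K ε ε Δt Δx)^[n] (F₀ ε)) i)
          (𝓝[>] 0) (𝓝 ((m.limitStep Δt Δx)^[n] U₀ i))) ∧
    -- the limiting scheme has order one in time and two in space
    (∃ C : ℝ, ∀ u : ℝ → ℝ → ℝ, m.IsParabolicSolution T u → HasDerivBounds T R u →
      ∀ (x₀ Δx Δt : ℝ) (N : ℕ), 0 < Δx → 0 < Δt → (N + 1) * Δt ≤ T → ∀ i : ℤ,
        |truncationError x₀ Δx Δt u ((N + 1) * Δt)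
            (m.limitStep Δt Δx (sampleAt x₀ Δx (fun x => u x (N * Δt)))) i|
          ≤ C * (Δt + Δx ^ 2)) := by
  have hstep : ∀ (Δt : ℝ) (N : ℕ), 0 < Δt → (N + 1) * Δt ≤ T →
      0 ≤ N * Δt ∧ N * Δt ≤ T ∧ (N + 1) * Δt = N * Δt + Δt := fun Δt N hΔt hN =>
    ⟨by positivity, by linarith, by ring⟩
  -- From `κ₁ Δx² ≤ Δt ≤ (N + 1) Δt ≤ T`; this provides the mesh bound `H = T / κ₁` required by the
  -- uniform estimates.
  have hmesh : ∀ (Δx Δt : ℝ) (N : ℕ), 0 < Δt → κ₁ * Δx ^ 2 ≤ Δt → (N + 1) * Δt ≤ T →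
      Δx ^ 2 ≤ T / κ₁ := fun Δx Δt N hΔt h hN => by
    rw [le_div_iff₀ hκ₁]
    linarith [(hstep Δt N hΔt hN).1]
  refine ⟨?_, ?_, fun Δx Δt _ _ U₀ F₀ hU hb n i =>
    ((isBoundedFamily_of_abs_le hU hb).pfeStep_iterate hK Δt Δx n).density i, ?_⟩
  · obtain ⟨C, hC⟩ := m.exists_bound_truncationError_kinetic K hT R hκ₁ (T / κ₁)
    refine ⟨C, fun ε hε hε1 f hf hR x₀ Δx Δt N hΔx hΔt _ hN i => ?_⟩
    have hpos : 0 < Δt := lt_of_lt_of_le (by positivity) hΔt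
    obtain ⟨h0, h1, h2⟩ := hstep Δt N hpos hN
    rw [h2]
    exact hC ⟨ε, Δx, N * Δt, f, hε, hε1, hΔx, hmesh Δx Δt N hpos hΔt hN, h0, h1, hf, hR⟩ x₀ Δt i
      hpos hΔt (h2 ▸ hN)
  · obtain ⟨C, hC⟩ := m.exists_bound_truncationError_parabolic K R hκ₁ (T / κ₁)
    refine ⟨C, fun ε hε hε1 u hu hR x₀ Δx Δt N hΔx hΔt _ hN φ hφ i => ?_⟩
    have hpos : 0 < Δt := lt_of_lt_of_le (by positivity) hΔt
    obtain ⟨h0, h1, h2⟩ := hstep Δt N hpos hN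
    rw [h2]
    exact hC ⟨ε, Δx, N * Δt, u, φ, hε, hε1, hΔx, hmesh Δx Δt N hpos hΔt hN, h0, h1, hu, hR, hφ⟩
      x₀ Δt i hpos hΔt (h2 ▸ hN)
  · obtain ⟨C, hC⟩ := m.exists_bound_truncationError_limit R
    refine ⟨C, fun u hu hR x₀ Δx Δt N hΔx hpos hN i => ?_⟩
    obtain ⟨h0, h1, h2⟩ := hstep Δt N hpos hN
    rw [h2]
    exact hC ⟨Δx, N * Δt, u, hΔx, h0, h1, hu, hR⟩ x₀ Δt i hpos (h2 ▸ hN)
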